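/- Let $d\ge 1$. For $f\in L^2(\mathbb{R}^d)$ (complex-valued) let $\widehat f\in L^2(\mathbb{R}^d)$ denote its Fourier transform, i.e. the unitary extension to $L^2$ of $\widehat f(y)=\int_{\mathbb{R}^d}f(t)e^{-2i\pi\langle t,y\rangle}\,dt$. Then the following are equivalent. (i) There are a real symmetric positive definite $d\times d$ matrix $A$ and a polynomial $P$ in $d$ variables with complex coefficients such that $f(x)=P(x)e^{-\pi\langle Ax,x\rangle}$ for almost every $x\in\mathbb{R}^d$. (ii) The function $(x,y)\mapsto f(x)\,\widehat f(y)\,e^{2\pi|\langle x,y\rangle|}$ is slowly increasing on $\mathbb{R}^d\times\mathbb{R}^d$; that is, there are $C\in\mathbb{R}$ and an integer $N\ge 0$ such that $$|f(x)|\,|\widehat f(y)|\,e^{2\pi|\langle x,y\rangle|}\le C\,(1+\|x\|+\|y\|)^N\qquad\text{for almost every }(x,y)\in\mathbb{R}^d\times\mathbb{R}^d .$$ -/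

import Mathlib

open MeasureTheory
open scoped FourierTransform Matrix

/-- A complex-valued function on `E × E`, considered up to equality almost everywhere, is
slowly increasing (of at most polynomial growth) if it satisfies a bound
`|F (x, y)| ≤ C (1 + ‖x‖ + ‖y‖) ^ N` for almost every `(x, y)`. -/
def IsSlowlyIncreasing {E : Type*} [NormedAddCommGroup E] [MeasureSpace E]
    (F : E × E → ℂ) : Prop :=
  ∃ (C : ℝ) (N : ℕ), ∀ᵐ z : E × E, ‖F z‖ ≤ C * (1 + ‖z.1‖ + ‖z.2‖) ^ N

/-- The function `P(x) exp(-π⟨Ax, x⟩)` on `ℝ^d`, for a polynomial `P` with complex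
coefficients and a real matrix `A`. -/
noncomputable def polyGaussian {d : ℕ} (P : MvPolynomial (Fin d) ℂ)
    (A : Matrix (Fin d) (Fin d) ℝ) (x : EuclideanSpace ℝ (Fin d)) : ℂ :=
  MvPolynomial.eval (fun i => (x i : ℂ)) P *
    (Real.exp (-Real.pi * ((A *ᵥ x.ofLp) ⬝ᵥ x.ofLp)) : ℂ)

/-! From (i) to (ii): the Fourier transform carries a polynomial times the Gaussian of `A` to a
polynomial times the Gaussian of `A⁻¹` (`exists_fourier_polyGaussian`), and 2|⟨x,y⟩| ≤ ⟨Ax,x⟩ +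
⟨A⁻¹y,y⟩ (`Matrix.PosDef.two_mul_abs_inner_le`) makes the two Gaussians absorb the exponential
weight.

From (ii) to (i), for f ≠ 0: write F for the transform of f, and let g be the inverse transform of
F(y)exp(-π‖y‖²), that is, f convolved with a Gaussian. The damping makes g entire on ℂ^d of order at
most two. Since f spreads only at Gaussian cost, the hypothesis survives the convolution, and
integrating it in y bounds |g(x)| ∫|F(y)|exp(-π‖y‖² + 2π|⟨x,y⟩|)dy polynomially
(`exists_entireFourierInv_mul_integral_le`). The integral at rx dominates |g(wx)| whenever |Im w| ≤
|r|, so on each real line |g(rx)||g(wx)| has polynomial growth in r.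

Phragmén–Lindelöf then shows that g(zx)g(izx) has polynomial growth in z, hence is a polynomial
(`norm_mul_rotate_le`). An entire function of order at most two dividing a polynomial is a
polynomial times the exponential of a quadratic, and the product with the rotated copy excludes a
linear term: g(zx) = p(z)exp(az²). Here p and a depend on x. The exponent a(x) is half the quotient
of two polynomials in x, and the order bound on g gives |a(x)| = O(‖x‖²), so the division is exact
and a is a quadratic form (`MvPolynomial.exists_eq_polynomial_mul_exp`). The growth condition makes
it real on ℝ^d.

So g is a polynomial times a Gaussian, definite by the Riemann–Lebesgue lemma. Transforming back and
removing the damping, F is a polynomial times a Gaussian with matrix B⁻¹ - 1. Hypothesis (ii) at one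
good x forces F to decay along every line, so this matrix is positive definite, and inverting the
transform yields f. -/

/-! ### Entire functions of one variable and their power series -/

/-- The power series `A` converges on all of `ℂ`, with sum `φ`. -/
def RepresentsEntire (A : PowerSeries ℂ) (φ : ℂ → ℂ) : Prop :=
  ∀ z, HasSum (fun n => PowerSeries.coeff n A * z ^ n) (φ z)

namespace RepresentsEntire

variable {A B : PowerSeries ℂ} {φ ψ : ℂ → ℂ}

theorem mul (hA : RepresentsEntire A φ) (hB : RepresentsEntire B ψ) :
    RepresentsEntire (A * B) (fun z => φ z * ψ z) := by
  intro z
  have h1 := (hA z).summable.norm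
  have h2 := (hB z).summable.norm
  have h3 := (summable_norm_sum_mul_antidiagonal_of_summable_norm h1 h2).of_norm.hasSum
  rw [← tsum_mul_tsum_eq_tsum_sum_antidiagonal_of_summable_norm h1 h2, (hA z).tsum_eq,
    (hB z).tsum_eq] at h3
  refine h3.congr_fun fun n => ?_
  rw [PowerSeries.coeff_mul, Finset.sum_mul]
  refine Finset.sum_congr rfl fun p hp => ?_
  rw [← Finset.HasAntidiagonal.mem_antidiagonal.1 hp, pow_add]
  ring

theorem hasFPowerSeriesOnBall (hA : RepresentsEntire A φ) :
    HasFPowerSeriesOnBall φ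
      (FormalMultilinearSeries.ofScalars ℂ (fun n => PowerSeries.coeff n A)) 0 ⊤ where
  r_le := by
    refine top_le_iff.2 (ENNReal.eq_top_of_forall_nnreal_le fun r => ?_)
    refine FormalMultilinearSeries.le_radius_of_summable _ ?_
    refine (hA r).summable.norm.congr fun n => ?_
    simp
  r_pos := by simp
  hasSum := by
    intro y _
    simpa [FormalMultilinearSeries.ofScalars_apply_eq, mul_comm] using hA y

theorem differentiable (hA : RepresentsEntire A φ) : Differentiable ℂ φ := by
  have h := hA.hasFPowerSeriesOnBall.differentiableOn
  simpa [differentiableOn_univ] using h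

theorem unique (hA : RepresentsEntire A φ) (hB : RepresentsEntire B φ) : A = B := by
  have h := hA.hasFPowerSeriesOnBall.hasFPowerSeriesAt.eq_formalMultilinearSeries
    hB.hasFPowerSeriesOnBall.hasFPowerSeriesAt
  ext n
  have := congrArg (fun p => FormalMultilinearSeries.coeff p n) h
  simpa [FormalMultilinearSeries.coeff_ofScalars] using this

theorem mk_iteratedDeriv (hφ : Differentiable ℂ φ) :
    RepresentsEntire (PowerSeries.mk fun n => (n.factorial : ℂ)⁻¹ * iteratedDeriv n φ 0) φ := by
  intro z
  refine (Complex.hasSum_taylorSeries_of_entire hφ 0 z).congr_fun fun n => ?_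
  simp only [PowerSeries.coeff_mk, smul_eq_mul, sub_zero]
  ring

theorem coeff_eq (hA : RepresentsEntire A φ) (n : ℕ) :
    PowerSeries.coeff n A = (n.factorial : ℂ)⁻¹ * iteratedDeriv n φ 0 := by
  rw [hA.unique (mk_iteratedDeriv hA.differentiable), PowerSeries.coeff_mk]

/-- Liouville's theorem for functions of polynomial growth. -/
theorem coeff_eq_zero_of_growth (hA : RepresentsEntire A φ) {C : ℝ} {M : ℕ}
    (h : ∀ z, ‖φ z‖ ≤ C * (1 + ‖z‖) ^ M) {n : ℕ} (hn : M < n) : PowerSeries.coeff n A = 0 := by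
  have hC : 0 ≤ C := by simpa using (norm_nonneg _).trans (h 0)
  rw [hA.coeff_eq]
  suffices H : ‖iteratedDeriv n φ 0‖ ≤ 0 by simp [norm_le_zero_iff.1 H]
  -- Cauchy's estimate on the circle of radius R; `M < n` leaves at least one factor `R⁻¹`.
  have key : ∀ R : ℝ, 1 ≤ R → ‖iteratedDeriv n φ 0‖ ≤ (n.factorial * C * 2 ^ M) * R⁻¹ := by
    intro R hR
    have h0 : (0 : ℝ) < R := by linarith
    refine (Complex.norm_iteratedDeriv_le_of_forall_mem_sphere_norm_le n h0
      hA.differentiable.diffContOnCl (C := C * (2 * R) ^ M) fun z hz => ?_).trans ?_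
    · refine (h z).trans ?_
      rw [mem_sphere_zero_iff_norm.1 hz]
      gcongr
      linarith
    · rw [div_le_iff₀ (by positivity), mul_pow]
      have : R ^ M ≤ R⁻¹ * R ^ n := by
        obtain ⟨k, rfl⟩ := Nat.exists_eq_add_of_lt hn
        rw [pow_succ, pow_add]
        field_simp
        exact one_le_pow₀ hR
      calc (n.factorial : ℝ) * (C * (2 ^ M * R ^ M)) = (n.factorial * C * 2 ^ M) * R ^ M := by ring
        _ ≤ (n.factorial * C * 2 ^ M) * (R⁻¹ * R ^ n) := by gcongr
        _ = _ := by ring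
  have hlim : Filter.Tendsto (fun R : ℝ => (n.factorial * C * 2 ^ M) * R⁻¹) Filter.atTop (nhds 0) := by
    simpa using tendsto_inv_atTop_zero.const_mul ((n.factorial : ℝ) * C * 2 ^ M)
  exact ge_of_tendsto hlim (Filter.eventually_atTop.2 ⟨1, key⟩)

theorem polynomial (p : Polynomial ℂ) :
    RepresentsEntire (p : PowerSeries ℂ) (fun z => p.eval z) := by
  intro z
  simp only [Polynomial.eval_eq_sum_range, Polynomial.coeff_coe]
  refine hasSum_sum_of_ne_finset_zero fun n hn => ?_
  rw [Polynomial.coeff_eq_zero_of_natDegree_lt (by simpa using hn), zero_mul]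

theorem rescale (hA : RepresentsEntire A φ) (c : ℂ) :
    RepresentsEntire (PowerSeries.rescale c A) (fun z => φ (c * z)) := by
  intro z
  refine (hA (c * z)).congr_fun fun n => ?_
  rw [PowerSeries.coeff_rescale, mul_pow]
  ring

end RepresentsEntire

/-- The power series of `exp (a z ^ 2)`. -/
noncomputable def gaussianSeries {R : Type*} [CommRing R] [Algebra ℚ R] (a : R) : PowerSeries R :=
  PowerSeries.mk fun n => if Even n then algebraMap ℚ R ((n / 2).factorial : ℚ)⁻¹ * a ^ (n / 2) else 0

theorem map_gaussianSeries {R S : Type*} [CommRing R] [Algebra ℚ R] [CommRing S] [Algebra ℚ S]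
    (f : R →+* S) (a : R) : PowerSeries.map f (gaussianSeries a) = gaussianSeries (f a) := by
  ext n
  simp only [gaussianSeries, PowerSeries.coeff_map, PowerSeries.coeff_mk]
  split_ifs
  · rw [map_mul, map_pow]
    congr 1
    exact congrFun (congrArg DFunLike.coe (RingHom.ext_rat (f.comp (algebraMap ℚ R)) (algebraMap ℚ S))) _
  · simp

theorem representsEntire_gaussianSeries (a : ℂ) :
    RepresentsEntire (gaussianSeries a) (fun z => Complex.exp (a * z ^ 2)) := by
  intro z
  have h := NormedSpace.expSeries_div_hasSum_exp (𝔸 := ℂ) (a * z ^ 2)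
  rw [← Complex.exp_eq_exp_ℂ] at h
  have hinj : Function.Injective (fun n : ℕ => 2 * n) := fun a b h => by simpa using h
  refine (hinj.hasSum_iff ?_).1 (h.congr_fun fun n => ?_)
  · intro n hn
    have : ¬ Even n := fun h => hn (by obtain ⟨k, rfl⟩ := h; exact ⟨k, by simp; ring⟩)
    simp [gaussianSeries, this]
  · have : Even (2 * n) := ⟨n, by ring⟩
    simp only [gaussianSeries, PowerSeries.coeff_mk, Function.comp, this, if_true]
    rw [mul_pow, ← pow_mul, Nat.mul_div_cancel_left n two_pos, map_inv₀, map_natCast]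
    ring

theorem derivative_gaussianSeries (a : ℂ) :
    PowerSeries.derivative ℂ (gaussianSeries a) =
      PowerSeries.C (2 * a) * PowerSeries.X * gaussianSeries a := by
  ext n
  rw [PowerSeries.coeff_derivative, mul_assoc, PowerSeries.coeff_C_mul]
  rcases n with _ | n
  · simp [gaussianSeries]
  rw [PowerSeries.coeff_succ_X_mul]
  simp only [gaussianSeries, PowerSeries.coeff_mk]
  by_cases hn : Even n
  · obtain ⟨k, rfl⟩ := hn
    have h1 : Even (k + k + 1 + 1) := ⟨k + 1, by ring⟩
    have h2 : (k + k + 1 + 1) / 2 = k + 1 := by omega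
    have h3 : (k + k) / 2 = k := by omega
    rw [if_pos h1, if_pos (by simp), h2, h3, Nat.factorial_succ]
    push_cast
    have : (k.factorial : ℂ) ≠ 0 := by exact_mod_cast k.factorial_ne_zero
    have : (k + 1 : ℂ) ≠ 0 := by exact_mod_cast k.succ_ne_zero
    field_simp
    ring
  · have h1 : ¬ Even (n + 1 + 1) := by simpa [Nat.even_add_one] using hn
    rw [if_neg h1, if_neg hn]
    simp

/-! ### Growth and factorization of entire functions of order at most two -/

/-- A nonzero polynomial times a growing exponential is not of polynomial growth. -/
theorem Polynomial.nonpos_of_eval_mul_exp_le {p : Polynomial ℂ} (hp : p ≠ 0) {s C : ℝ} {M : ℕ}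
    (h : ∀ t : ℝ, 1 ≤ t → ‖p.eval (t : ℂ)‖ * Real.exp (s * t) ≤ C * (1 + t) ^ M) : s ≤ 0 := by
  by_contra! hs
  -- A nonzero polynomial stays away from zero at infinity, so the exponential is not compensated.
  obtain ⟨c, hc, hpc⟩ : ∃ c > 0, ∀ᶠ t : ℝ in Filter.atTop, c ≤ ‖p.eval (t : ℂ)‖ := by
    by_cases hd : 0 < p.degree
    · have hz : Filter.Tendsto (fun t : ℝ => ‖(t : ℂ)‖) Filter.atTop Filter.atTop := by
        simpa using Filter.tendsto_abs_atTop_atTop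
      exact ⟨1, one_pos, (p.tendsto_norm_atTop hd hz).eventually_ge_atTop 1⟩
    · rw [Polynomial.eq_C_of_degree_le_zero (not_lt.1 hd)] at hp ⊢
      refine ⟨‖p.coeff 0‖, norm_pos_iff.2 fun h => hp (by rw [h, Polynomial.C_0]), ?_⟩
      simp
  have ho := (isLittleO_pow_exp_pos_mul_atTop M hs).bound
    (c := c / (2 * (|C| + 1) * 2 ^ M)) (by positivity)
  obtain ⟨t, ht, h1, h2⟩ := (ho.and (hpc.and (Filter.eventually_ge_atTop 1))).exists
  have h3 := h t h2
  rw [Real.norm_of_nonneg (by positivity), Real.norm_of_nonneg (by positivity),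
    div_mul_eq_mul_div, le_div_iff₀ (by positivity)] at ht
  have hE := Real.exp_pos (s * t)
  have h4 : C * (1 + t) ^ M ≤ (|C| + 1) * (2 ^ M * t ^ M) := by
    rw [← mul_pow]
    gcongr
    · linarith [le_abs_self C]
    · linarith
  nlinarith [mul_le_mul_of_nonneg_right h1 hE.le, mul_pos hc hE]

theorem Polynomial.nonpos_of_eval_mul_exp_sq_le {p : Polynomial ℂ} (hp : p ≠ 0) {s C : ℝ} {M : ℕ}
    (h : ∀ t : ℝ, 1 ≤ t → ‖p.eval (t : ℂ)‖ * Real.exp (s * t ^ 2) ≤ C * (1 + t) ^ M) : s ≤ 0 := by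
  by_contra! hs
  refine hs.not_ge (Polynomial.nonpos_of_eval_mul_exp_le hp fun t ht => (h t ht).trans' ?_)
  gcongr
  nlinarith

/-- An entire function without zeros has an entire logarithm. -/
theorem Differentiable.exists_exp_eq {h : ℂ → ℂ} (hh : Differentiable ℂ h) (h0 : ∀ z, h z ≠ 0) :
    ∃ φ : ℂ → ℂ, Differentiable ℂ φ ∧ ∀ z, h z = Complex.exp (φ z) := by
  have hd : Differentiable ℂ (_root_.deriv h) := by
    have := (hh.differentiableOn (s := Set.univ)).deriv isOpen_univ
    rwa [differentiableOn_univ] at this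
  obtain ⟨φ, hφ0, hφ⟩ := (hd.div hh h0).isExactOn_univ.with_val_at 0 (Complex.log (h 0))
  have hφ' : ∀ z, HasDerivAt φ (_root_.deriv h z / h z) z := fun z => hφ z trivial
  refine ⟨φ, fun z => (hφ' z).differentiableAt, fun z => ?_⟩
  have hq : ∀ z, HasDerivAt (fun z => h z * Complex.exp (-φ z)) 0 z := fun z => by
    have h1 := (hh z).hasDerivAt.mul (hφ' z).neg.cexp
    refine h1.congr_deriv ?_
    have := h0 z
    simp only [Pi.neg_apply]
    field_simp
    ring
  have hc := is_const_of_deriv_eq_zero (fun z => (hq z).differentiableAt) (fun z => (hq z).deriv) z 0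
  simp only [hφ0, Complex.exp_neg, Complex.exp_log (h0 0), mul_inv_cancel₀ (h0 0)] at hc
  field_simp [Complex.exp_ne_zero] at hc
  exact hc

/-- An entire function whose real part grows at most quadratically is a quadratic polynomial. -/
theorem Differentiable.eq_quadratic_of_re_le {φ : ℂ → ℂ} (hφ : Differentiable ℂ φ) {C : ℝ}
    (h : ∀ z, (φ z).re ≤ C * (1 + ‖z‖) ^ 2) : ∃ a b c : ℂ, ∀ z, φ z = a * z ^ 2 + b * z + c := by
  have hA := RepresentsEntire.mk_iteratedDeriv hφ
  set A := PowerSeries.mk fun n => (n.factorial : ℂ)⁻¹ * iteratedDeriv n φ 0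
  -- Borel–Carathéodory on the disc of radius 2(1 + ‖z‖), with `|C| + 1` to keep the bound on the
  -- real part positive. The constant 18 is 2·3², from 1 + 2(1 + ‖z‖) ≤ 3(1 + ‖z‖).
  have hbound : ∀ z, ‖φ z‖ ≤ (18 * (|C| + 1) + 3 * ‖φ 0‖) * (1 + ‖z‖) ^ 2 := by
    intro z
    have hz := norm_nonneg z
    have hR : 0 < 2 * (1 + ‖z‖) := by positivity
    have hM : 0 < (|C| + 1) * (1 + 2 * (1 + ‖z‖)) ^ 2 := by positivity
    have hb := Complex.borelCaratheodory (f := φ) hM hφ.differentiableOn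
      (R := 2 * (1 + ‖z‖)) (z := z) ?_ hR ?_
    · refine hb.trans ?_
      rw [← add_div, div_le_iff₀ (by linarith)]
      have h0 := norm_nonneg (φ 0)
      have hC := abs_nonneg C
      have h1 : 2 * ((|C| + 1) * (1 + 2 * (1 + ‖z‖)) ^ 2) * ‖z‖ ≤
          18 * (|C| + 1) * (1 + ‖z‖) ^ 2 * (2 * (1 + ‖z‖) - ‖z‖) := by
        have : (1 + 2 * (1 + ‖z‖)) ^ 2 ≤ 9 * (1 + ‖z‖) ^ 2 := by nlinarith
        calc 2 * ((|C| + 1) * (1 + 2 * (1 + ‖z‖)) ^ 2) * ‖z‖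
            ≤ 2 * ((|C| + 1) * (9 * (1 + ‖z‖) ^ 2)) * (2 * (1 + ‖z‖) - ‖z‖) := by
              gcongr
              linarith
          _ = _ := by ring
      have h2 : ‖φ 0‖ * (2 * (1 + ‖z‖) + ‖z‖) ≤
          3 * ‖φ 0‖ * (1 + ‖z‖) ^ 2 * (2 * (1 + ‖z‖) - ‖z‖) := by
        calc ‖φ 0‖ * (2 * (1 + ‖z‖) + ‖z‖) ≤ ‖φ 0‖ * (3 * 1 * (2 * (1 + ‖z‖) - ‖z‖)) := by
              gcongr; linarith
          _ ≤ ‖φ 0‖ * (3 * (1 + ‖z‖) ^ 2 * (2 * (1 + ‖z‖) - ‖z‖)) := by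
              gcongr
              · linarith
              · exact one_le_pow₀ (by linarith)
          _ = _ := by ring
      linarith
    · intro w hw
      have hw' : ‖w‖ < 2 * (1 + ‖z‖) := by simpa using hw
      refine (h w).trans ?_
      gcongr
      linarith [le_abs_self C]
    · rw [mem_ball_zero_iff]; linarith
  refine ⟨PowerSeries.coeff 2 A, PowerSeries.coeff 1 A, PowerSeries.coeff 0 A, fun z => ?_⟩
  have := hasSum_sum_of_ne_finset_zero (L := SummationFilter.unconditional ℕ) (s := Finset.range 3)
    (f := fun n => PowerSeries.coeff n A * z ^ n) fun n hn => by
      rw [hA.coeff_eq_zero_of_growth hbound (not_le.1 fun h => hn (Finset.mem_range.2 (by omega))), zero_mul]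
  rw [(hA z).unique this]
  simp [Finset.sum_range_succ]
  ring

theorem Differentiable.eq_exp_quadratic {h : ℂ → ℂ} (hh : Differentiable ℂ h) (h0 : ∀ z, h z ≠ 0)
    {C K : ℝ} (hK : 0 ≤ K) (hC : ∀ z, ‖h z‖ ≤ C * Real.exp (K * ‖z‖ ^ 2)) :
    ∃ (P : Polynomial ℂ) (a b c : ℂ),
      ∀ z, h z = P.eval z * Complex.exp (a * z ^ 2 + b * z + c) := by
  obtain ⟨φ, hφ, hφh⟩ := hh.exists_exp_eq h0
  have hCpos : 0 < C := by
    have := (norm_pos_iff.2 (h0 0)).trans_le (hC 0)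
    simpa using this
  obtain ⟨a, b, c, habc⟩ := hφ.eq_quadratic_of_re_le (C := |Real.log C| + K) fun z => by
    have h1 : (φ z).re = Real.log ‖h z‖ := by rw [hφh, Complex.norm_exp, Real.log_exp]
    rw [h1]
    refine (Real.log_le_log (norm_pos_iff.2 (h0 z)) (hC z)).trans ?_
    rw [Real.log_mul hCpos.ne' (Real.exp_pos _).ne', Real.log_exp, add_mul]
    have hz := norm_nonneg z
    gcongr
    · refine (le_abs_self _).trans (le_mul_of_one_le_right (abs_nonneg _) ?_)
      exact one_le_pow₀ (by linarith)
    · linarith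
  exact ⟨1, a, b, c, fun z => by rw [hφh, habc, Polynomial.eval_one, one_mul]⟩

/-- An entire function of order at most two which divides a nonzero polynomial is the product of a
polynomial and the exponential of a quadratic polynomial. -/
theorem Differentiable.exists_polynomial_mul_exp {h k : ℂ → ℂ} {p : Polynomial ℂ}
    (hh : Differentiable ℂ h) (hk : Continuous k) (hp : p ≠ 0) (hhk : ∀ z, h z * k z = p.eval z)
    {C K : ℝ} (hK : 0 ≤ K) (hC : ∀ z, ‖h z‖ ≤ C * Real.exp (K * ‖z‖ ^ 2)) :
    ∃ (P : Polynomial ℂ) (a b c : ℂ),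
      ∀ z, h z = P.eval z * Complex.exp (a * z ^ 2 + b * z + c) := by
  induction hn : p.natDegree generalizing h p C with
  | zero =>
    have h0 : ∀ z, h z ≠ 0 := fun z hz => by
      rw [Polynomial.eq_C_of_natDegree_eq_zero hn] at hp hhk
      have := hhk z
      rw [hz, zero_mul, Polynomial.eval_C] at this
      exact hp (by rw [← this, Polynomial.C_0])
    exact hh.eq_exp_quadratic h0 hK hC
  | succ n ih =>
    by_cases h0 : ∀ z, h z ≠ 0
    · exact hh.eq_exp_quadratic h0 hK hC
    push Not at h0
    obtain ⟨r, hr⟩ := h0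
    have hmul : ∀ z, h z = (z - r) * dslope h r z := fun z => by
      have := sub_smul_dslope h r z
      rw [hr, sub_zero, smul_eq_mul] at this
      exact this.symm
    have hd : Differentiable ℂ (dslope h r) := by
      have := (Complex.differentiableOn_dslope (f := h) (c := r) Filter.univ_mem).2
        hh.differentiableOn
      rwa [differentiableOn_univ] at this
    have hroot : p.IsRoot r := by rw [Polynomial.IsRoot, ← hhk, hr, zero_mul]
    obtain ⟨p₁, rfl⟩ := Polynomial.dvd_iff_isRoot.2 hroot
    have hp₁ : p₁ ≠ 0 := right_ne_zero_of_mul hp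
    have hdeg : p₁.natDegree = n := by
      rw [Polynomial.natDegree_mul (Polynomial.X_sub_C_ne_zero r) hp₁,
        Polynomial.natDegree_X_sub_C] at hn
      omega
    -- Cancelling z - r is legitimate off r only; continuity fills in r, and this is all that is
    -- needed of `k`.
    have heq : ∀ z, dslope h r z * k z = p₁.eval z := by
      refine congrFun (Continuous.ext_on (dense_compl_singleton r) (hd.continuous.mul hk)
        p₁.continuous fun z hz => ?_)
      have h1 := hhk z
      rw [hmul, Polynomial.eval_mul] at h1
      simp only [Polynomial.eval_sub, Polynomial.eval_X, Polynomial.eval_C] at h1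
      rw [mul_assoc] at h1
      exact mul_left_cancel₀ (sub_ne_zero.2 hz) h1
    obtain ⟨B, hB⟩ := (isCompact_closedBall r 1).exists_bound_of_continuousOn
      hd.continuous.continuousOn
    -- Within distance 1 of r use compactness; farther away, dividing by z - r only decreases the
    -- norm. The rate `K` is unchanged, as the induction requires.
    have hgrow : ∀ z, ‖dslope h r z‖ ≤ (|C| + |B|) * Real.exp (K * ‖z‖ ^ 2) := fun z => by
      have h1 : 1 ≤ Real.exp (K * ‖z‖ ^ 2) := Real.one_le_exp (by positivity)
      rcases le_total ‖z - r‖ 1 with hz | hz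
      · have := hB z (mem_closedBall_iff_norm.2 hz)
        nlinarith [abs_nonneg B, abs_nonneg C, le_abs_self B]
      · have h2 := hC z
        rw [hmul, norm_mul] at h2
        nlinarith [abs_nonneg B, abs_nonneg C, le_abs_self C, norm_nonneg (dslope h r z)]
    obtain ⟨P, a, b, c, hP⟩ := ih hd hp₁ heq hgrow hdeg
    refine ⟨(Polynomial.X - Polynomial.C r) * P, a, b, c, fun z => ?_⟩
    rw [hmul, hP, Polynomial.eval_mul]
    simp only [Polynomial.eval_sub, Polynomial.eval_X, Polynomial.eval_C]
    ring

/-! ### Phragmén–Lindelöf in a quadrant -/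

theorem Complex.re_cpow_nonneg_of_quadrant {w : ℂ} (hre : 0 ≤ w.re) (him : 0 ≤ w.im) {β : ℝ}
    (hβ0 : 0 ≤ β) (hβ1 : β ≤ 1) : 0 ≤ (w ^ (β : ℂ)).re := by
  rw [Complex.cpow_ofReal_re]
  have h1 : 0 ≤ w.arg := Complex.arg_nonneg_iff.2 him
  have h2 : w.arg ≤ Real.pi / 2 := Complex.arg_le_pi_div_two_iff.2 (Or.inl hre)
  refine mul_nonneg (by positivity) (Real.cos_nonneg_of_mem_Icc ⟨?_, ?_⟩)
  · linarith [mul_nonneg h1 hβ0, Real.pi_pos]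
  · nlinarith

theorem Complex.one_le_norm_add_one {ζ : ℂ} (h : 0 ≤ ζ.re) : 1 ≤ ‖ζ + 1‖ := by
  refine le_trans ?_ (Complex.re_le_norm _)
  simpa using h

theorem Complex.one_add_norm_le_two_mul {ζ : ℂ} (h : 0 ≤ ζ.re) : 1 + ‖ζ‖ ≤ 2 * ‖ζ + 1‖ := by
  have h1 : ‖ζ‖ ^ 2 + 1 ≤ ‖ζ + 1‖ ^ 2 := by
    rw [Complex.sq_norm, Complex.sq_norm, Complex.normSq_apply, Complex.normSq_apply]
    simp
    nlinarith
  nlinarith [norm_nonneg ζ, norm_nonneg (ζ + 1), sq_nonneg (‖ζ‖ - 1)]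

section

variable {h k : ℂ → ℂ} {C C₁ C₂ K : ℝ} {M : ℕ}

/-- Phragmén–Lindelöf in a quadrant needs order strictly below 2, while h and k may have order
exactly 2. Composing with w ↦ w^β lowers the order to 2β. The image is a narrower sector, and the
unit factor u = exp(-iπβ/2) is chosen so that h is evaluated at a real point on one edge and k on
the other; there `h1` and `h2` apply. Dividing by (w^β + 1)^M turns polynomial bounds into constant
ones. -/
theorem norm_mul_le_of_cross_growth_cpow (hh : Differentiable ℂ h) (hk : Differentiable ℂ k)
    (hC₁ : ∀ z, ‖h z‖ ≤ C₁ * Real.exp (K * ‖z‖ ^ 2))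
    (hC₂ : ∀ z, ‖k z‖ ≤ C₂ * Real.exp (K * ‖z‖ ^ 2))
    (h1 : ∀ r : ℝ, 0 ≤ r → ∀ w : ℂ, |w.im| ≤ r → ‖h r‖ * ‖k w‖ ≤ C * (1 + r) ^ M)
    (h2 : ∀ r : ℝ, 0 ≤ r → ∀ w : ℂ, |w.im| ≤ r → ‖k (-r)‖ * ‖h w‖ ≤ C * (1 + r) ^ M)
    {β : ℝ} (hβ0 : 0 < β) (hβ1 : β < 1) {z : ℂ} (hre : 0 ≤ z.re) (him : 0 ≤ z.im) :
    ‖h (z ^ (β : ℂ))‖ * ‖k (-(Complex.exp (-(Real.pi / 2 * β * Complex.I)) * z ^ (β : ℂ)))‖ ≤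
      C * 2 ^ M * ‖z ^ (β : ℂ) + 1‖ ^ M := by
  have hC : 0 ≤ C := by simpa using (by positivity : 0 ≤ ‖h (0 : ℝ)‖ * ‖k 0‖).trans (h1 0 le_rfl 0 (by simp))
  set u : ℂ := Complex.exp (-(Real.pi / 2 * β * Complex.I)) with hu
  have hunorm : ‖u‖ = 1 := by
    rw [hu, Complex.norm_exp]
    simp
  set Ψ : ℂ → ℂ := fun w => h (w ^ (β : ℂ)) * k (-(u * w ^ (β : ℂ))) / (w ^ (β : ℂ) + 1) ^ M with hΨ
  have hden : ∀ w : ℂ, 0 ≤ w.re → 0 ≤ w.im → 1 ≤ ‖w ^ (β : ℂ) + 1‖ := fun w h1 h2 =>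
    Complex.one_le_norm_add_one (Complex.re_cpow_nonneg_of_quadrant h1 h2 hβ0.le hβ1.le)
  have hden0 : ∀ w : ℂ, 0 ≤ w.re → 0 ≤ w.im → w ^ (β : ℂ) + 1 ≠ 0 := fun w h1 h2 =>
    norm_pos_iff.1 (one_pos.trans_le (hden w h1 h2))
  have key : ‖Ψ z‖ ≤ C * 2 ^ M := by
    -- The goals are holomorphy inside, continuity up to the boundary, growth of order 2β < 2, and
    -- the bounds on the two edges.
    refine PhragmenLindelof.quadrant_I ⟨?_, ?_⟩ ⟨2 * β, by linarith, 2 * K, ?_⟩ ?_ ?_ hre him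
    · intro w hw
      rw [Complex.mem_reProdIm, Set.mem_Ioi, Set.mem_Ioi] at hw
      have hpow : DifferentiableAt ℂ (fun w : ℂ => w ^ (β : ℂ)) w :=
        differentiableAt_id.cpow_const (Or.inl hw.1)
      refine DifferentiableAt.differentiableWithinAt ?_
      refine DifferentiableAt.div (((hh _).comp w hpow).mul
        ((hk _).comp w (hpow.const_mul u).neg)) ((hpow.add_const 1).pow M)
        (pow_ne_zero _ (hden0 w hw.1.le hw.2.le))
    · rw [Complex.closure_reProdIm, closure_Ioi]
      intro w hw
      rw [Complex.mem_reProdIm, Set.mem_Ici, Set.mem_Ici] at hw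
      have hpow : ContinuousAt (fun w : ℂ => w ^ (β : ℂ)) w :=
        Complex.continuousAt_cpow_const_of_re_pos (Or.inl hw.1) (by simpa using hβ0)
      refine ContinuousAt.continuousWithinAt ?_
      refine ContinuousAt.div (((hh.continuous.continuousAt).comp hpow).mul
        ((hk.continuous.continuousAt).comp (hpow.const_mul u).neg)) ((hpow.add_const 1).pow M)
        (pow_ne_zero _ (hden0 w hw.1 hw.2))
    · refine Asymptotics.IsBigO.of_bound (C₁ * C₂) ?_
      refine Filter.eventually_inf_principal.2 (Filter.Eventually.of_forall fun w hw => ?_)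
      rw [Complex.mem_reProdIm, Set.mem_Ioi, Set.mem_Ioi] at hw
      have hn : ‖w ^ (β : ℂ)‖ = ‖w‖ ^ β := Complex.norm_cpow_real w β
      have hn2 : (‖w‖ ^ β) ^ 2 = ‖w‖ ^ (2 * β) := by
        rw [← Real.rpow_natCast, ← Real.rpow_mul (norm_nonneg _)]; congr 1; push_cast; ring
      have e1 := hC₁ (w ^ (β : ℂ))
      have e2 := hC₂ (-(u * w ^ (β : ℂ)))
      rw [hn, hn2] at e1
      rw [norm_neg, norm_mul, hunorm, one_mul, hn, hn2] at e2
      rw [hΨ, norm_div, norm_mul, norm_pow, Real.norm_of_nonneg (Real.exp_pos _).le]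
      refine (div_le_self (by positivity) (one_le_pow₀ (hden w hw.1.le hw.2.le))).trans ?_
      refine (mul_le_mul e1 e2 (norm_nonneg _) ((norm_nonneg _).trans e1)).trans (le_of_eq ?_)
      rw [mul_mul_mul_comm, ← Real.exp_add]
      ring_nf
    · intro x hx
      have hx' : (x : ℂ) ^ (β : ℂ) = ((x ^ β : ℝ) : ℂ) := (Complex.ofReal_cpow hx β).symm
      have hr : 0 ≤ x ^ β := Real.rpow_nonneg hx β
      have hw : |(-(u * ((x ^ β : ℝ) : ℂ))).im| ≤ x ^ β := by
        refine (Complex.abs_im_le_norm _).trans ?_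
        rw [norm_neg, norm_mul, hunorm, one_mul, Complex.norm_of_nonneg hr]
      have hb := h1 _ hr _ hw
      simp only [hΨ, hx', norm_div, norm_mul, norm_pow]
      have hd : ‖((x ^ β : ℝ) : ℂ) + 1‖ = 1 + x ^ β := by
        rw [← Complex.ofReal_one, ← Complex.ofReal_add, Complex.norm_of_nonneg (by positivity),
          add_comm]
      rw [hd, div_le_iff₀ (by positivity)]
      refine hb.trans ?_
      have : (1 : ℝ) ≤ 2 ^ M := one_le_pow₀ (by norm_num)
      have h3 : 0 ≤ C * (1 + x ^ β) ^ M := by positivity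
      nlinarith
    · intro x hx
      have hr : 0 ≤ x ^ β := Real.rpow_nonneg hx β
      have hnn : 0 ≤ (((x : ℂ) * Complex.I) ^ (β : ℂ)).re :=
        Complex.re_cpow_nonneg_of_quadrant (by simp) (by simpa using hx) hβ0.le hβ1.le
      -- On the imaginary axis the argument of w^β is πβ/2, which u cancels exactly. The vertex is
      -- treated apart because of the logarithm.
      have hx' : u * ((x : ℂ) * Complex.I) ^ (β : ℂ) = ((x ^ β : ℝ) : ℂ) := by
        rcases hx.eq_or_lt with rfl | hx0
        · rw [Complex.ofReal_zero, zero_mul, Complex.zero_cpow (by exact_mod_cast hβ0.ne'),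
            Real.zero_rpow hβ0.ne']
          simp
        · rw [Complex.cpow_def_of_ne_zero (by simp [hx0.ne']), Complex.log_ofReal_mul hx0 Complex.I_ne_zero,
            Complex.log_I, hu, ← Complex.exp_add, Complex.ofReal_cpow hx,
            Complex.cpow_def_of_ne_zero (by simpa using hx0.ne'), Complex.ofReal_log hx]
          congr 1
          ring
      have hn : ‖((x : ℂ) * Complex.I) ^ (β : ℂ)‖ = x ^ β := by
        have := congrArg norm hx'
        rwa [norm_mul, hunorm, one_mul, Complex.norm_of_nonneg hr] at this
      have hb := h2 _ hr (((x : ℂ) * Complex.I) ^ (β : ℂ)) ((Complex.abs_im_le_norm _).trans hn.le)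
      simp only [hΨ, hx', norm_div, norm_mul, norm_pow]
      have hd := Complex.one_add_norm_le_two_mul hnn
      rw [hn] at hd
      rw [div_le_iff₀ (by have := one_pos.trans_le (Complex.one_le_norm_add_one hnn); positivity)]
      rw [mul_comm]
      refine hb.trans ?_
      rw [mul_assoc, ← mul_pow]
      gcongr
  rwa [hΨ, norm_div, norm_mul, norm_pow, div_le_iff₀] at key
  have := one_pos.trans_le (hden z hre him)
  positivity

/-- The preceding bound does not depend on β, so β → 1 from below is allowed; then u → -i and -(u
z^β) → iz. -/
theorem norm_mul_le_of_cross_growth (hh : Differentiable ℂ h) (hk : Differentiable ℂ k)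
    (hC₁ : ∀ z, ‖h z‖ ≤ C₁ * Real.exp (K * ‖z‖ ^ 2))
    (hC₂ : ∀ z, ‖k z‖ ≤ C₂ * Real.exp (K * ‖z‖ ^ 2))
    (h1 : ∀ r : ℝ, 0 ≤ r → ∀ w : ℂ, |w.im| ≤ r → ‖h r‖ * ‖k w‖ ≤ C * (1 + r) ^ M)
    (h2 : ∀ r : ℝ, 0 ≤ r → ∀ w : ℂ, |w.im| ≤ r → ‖k (-r)‖ * ‖h w‖ ≤ C * (1 + r) ^ M)
    {z : ℂ} (hre : 0 ≤ z.re) (him : 0 ≤ z.im) :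
    ‖h z‖ * ‖k (Complex.I * z)‖ ≤ C * 2 ^ M * (1 + ‖z‖) ^ M := by
  have hC : 0 ≤ C := by simpa using (by positivity : 0 ≤ ‖h (0 : ℝ)‖ * ‖k 0‖).trans (h1 0 le_rfl 0 (by simp))
  rcases eq_or_ne z 0 with rfl | hz
  · have := h1 0 le_rfl 0 (by simp)
    have h3 : (1 : ℝ) ≤ 2 ^ M := one_le_pow₀ (by norm_num)
    simp at this ⊢
    nlinarith
  have hpow : Filter.Tendsto (fun β : ℝ => z ^ (β : ℂ)) (nhdsWithin 1 (Set.Iio 1)) (nhds z) := by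
    have hc : ContinuousAt (fun β : ℝ => z ^ (β : ℂ)) 1 :=
      (Complex.continuous_ofReal.continuousAt).const_cpow (Or.inl hz)
    have := hc.tendsto
    rw [Complex.ofReal_one, Complex.cpow_one] at this
    exact this.mono_left nhdsWithin_le_nhds
  have hu : Filter.Tendsto (fun β : ℝ => Complex.exp (-(Real.pi / 2 * β * Complex.I)))
      (nhdsWithin 1 (Set.Iio 1)) (nhds (-Complex.I)) := by
    have hc : Continuous (fun β : ℝ => Complex.exp (-(Real.pi / 2 * β * Complex.I))) := by fun_prop
    have := hc.tendsto 1
    rw [Complex.ofReal_one, mul_one, Complex.exp_neg, Complex.exp_pi_div_two_mul_I,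
      Complex.inv_I] at this
    exact this.mono_left nhdsWithin_le_nhds
  have hl : Filter.Tendsto (fun β : ℝ => ‖h (z ^ (β : ℂ))‖ *
      ‖k (-(Complex.exp (-(Real.pi / 2 * β * Complex.I)) * z ^ (β : ℂ)))‖)
      (nhdsWithin 1 (Set.Iio 1)) (nhds (‖h z‖ * ‖k (Complex.I * z)‖)) := by
    have h3 := (hu.mul hpow).neg
    rw [neg_mul, neg_neg] at h3
    exact (((hh.continuous.tendsto z).comp hpow).norm).mul
      (((hk.continuous.tendsto _).comp h3).norm)
  have hr : Filter.Tendsto (fun β : ℝ => C * 2 ^ M * ‖z ^ (β : ℂ) + 1‖ ^ M)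
      (nhdsWithin 1 (Set.Iio 1)) (nhds (C * 2 ^ M * ‖z + 1‖ ^ M)) :=
    ((hpow.add_const 1).norm.pow M).const_mul _
  refine (le_of_tendsto_of_tendsto hl hr ?_).trans ?_
  · filter_upwards [Ioo_mem_nhdsLT (zero_lt_one' ℝ)] with β hβ
    exact norm_mul_le_of_cross_growth_cpow hh hk hC₁ hC₂ h1 h2 hβ.1 hβ.2 hre him
  · gcongr
    refine (norm_add_le _ _).trans ?_
    rw [norm_one, add_comm]

/-- If `‖h r‖ ‖h w‖` is polynomially bounded in `r` for `|Im w| ≤ |r|`, and `h` has order at most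
two, then `h z * h (I z)` is of polynomial growth. -/
theorem norm_mul_rotate_le (hh : Differentiable ℂ h)
    (hC₁ : ∀ z, ‖h z‖ ≤ C₁ * Real.exp (K * ‖z‖ ^ 2))
    (h1 : ∀ (r : ℝ) (w : ℂ), |w.im| ≤ |r| → ‖h r‖ * ‖h w‖ ≤ C * (1 + |r|) ^ M) (z : ℂ) :
    ‖h z * h (Complex.I * z)‖ ≤ C * 2 ^ M * (1 + ‖z‖) ^ M := by
  have hh' : Differentiable ℂ (fun z => h (-z)) := hh.comp differentiable_neg
  have hC₁' : ∀ z, ‖h (-z)‖ ≤ C₁ * Real.exp (K * ‖z‖ ^ 2) := fun z => by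
    simpa using hC₁ (-z)
  have a1 : ∀ r : ℝ, 0 ≤ r → ∀ w : ℂ, |w.im| ≤ r → ‖h r‖ * ‖h w‖ ≤ C * (1 + r) ^ M :=
    fun r hr w hw => by simpa [abs_of_nonneg hr] using h1 r w (by rwa [abs_of_nonneg hr])
  have a2 : ∀ r : ℝ, 0 ≤ r → ∀ w : ℂ, |w.im| ≤ r → ‖h r‖ * ‖h (-w)‖ ≤ C * (1 + r) ^ M :=
    fun r hr w hw => a1 r hr (-w) (by simpa using hw)
  have a3 : ∀ r : ℝ, 0 ≤ r → ∀ w : ℂ, |w.im| ≤ r → ‖h (-r)‖ * ‖h w‖ ≤ C * (1 + r) ^ M :=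
    fun r hr w hw => by simpa [abs_of_nonneg hr] using h1 (-r) w (by simpa [abs_of_nonneg hr])
  have a4 : ∀ r : ℝ, 0 ≤ r → ∀ w : ℂ, |w.im| ≤ r → ‖h (-r)‖ * ‖h (-w)‖ ≤ C * (1 + r) ^ M :=
    fun r hr w hw => a3 r hr (-w) (by simpa using hw)
  rw [norm_mul]
  -- Each quadrant is rotated to the first, with h(z) or h(-z) in either role; the product h(z)h(iz)
  -- is recovered up to the order of its factors.
  rcases le_total 0 z.re with hre | hre <;> rcases le_total 0 z.im with him | him
  · exact norm_mul_le_of_cross_growth hh hh hC₁ hC₁ a1 a3 hre him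
  · have := norm_mul_le_of_cross_growth (z := Complex.I * z) hh hh' hC₁ hC₁' a2
      (fun r hr w hw => by simpa using a1 r hr w hw) (by simpa using him) (by simpa using hre)
    rw [mul_comm]
    simpa [← mul_assoc] using this
  · have := norm_mul_le_of_cross_growth (z := -Complex.I * z) hh' hh hC₁' hC₁ a3
      (fun r hr w hw => a4 r hr w hw) (by simpa using him) (by simpa using hre)
    rw [mul_comm]
    simpa [← mul_assoc] using this
  · have := norm_mul_le_of_cross_growth (z := -z) hh' hh' hC₁' hC₁' a4
      (fun r hr w hw => by simpa using a2 r hr w hw) (by simpa using hre) (by simpa using him)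
    simpa using this

end

/-! ### One complex line: functions of the form p(z)exp(az²) -/

theorem Polynomial.exists_norm_eval_le (p : Polynomial ℂ) :
    ∃ C : ℝ, ∀ z : ℂ, ‖p.eval z‖ ≤ C * (1 + ‖z‖) ^ p.natDegree := by
  refine ⟨∑ i ∈ Finset.range (p.natDegree + 1), ‖p.coeff i‖, fun z => ?_⟩
  rw [Polynomial.eval_eq_sum_range, Finset.sum_mul]
  refine (norm_sum_le _ _).trans (Finset.sum_le_sum fun i hi => ?_)
  rw [norm_mul, norm_pow]
  have hz := norm_nonneg z
  gcongr
  exact (pow_le_pow_left₀ hz (by linarith) i).trans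
    (pow_le_pow_right₀ (by linarith) (by simpa [Nat.lt_succ_iff] using hi))

theorem Polynomial.comp_C_mul_X_ne_zero {p : Polynomial ℂ} (hp : p ≠ 0) {c : ℂ} (hc : c ≠ 0) :
    p.comp (C c * X) ≠ 0 := by
  intro h
  rcases Polynomial.comp_eq_zero_iff.1 h with h | ⟨_, h⟩
  · exact hp h
  · have := congrArg (fun q => q.coeff 1) h
    simp [hc] at this

theorem Polynomial.eval_comp_C_mul_X (p : Polynomial ℂ) (c z : ℂ) :
    (p.comp (C c * X)).eval z = p.eval (c * z) := by simp

section

variable {G : PowerSeries ℂ} {h : ℂ → ℂ} {C K : ℝ}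

/-- Since (iz)² = -z², rotating by i inverts the Gaussian factor; this is why G(z)G(iz) is the right
product to study. -/
theorem gaussianSeries_mul_rescale_I (a : ℂ) :
    gaussianSeries a * PowerSeries.rescale Complex.I (gaussianSeries a) = 1 := by
  refine ((representsEntire_gaussianSeries a).mul
    ((representsEntire_gaussianSeries a).rescale Complex.I)).unique ?_
  have h1 := RepresentsEntire.polynomial 1
  rw [Polynomial.coe_one] at h1
  convert! h1 using 2 with z
  rw [mul_pow, Complex.I_sq, ← Complex.exp_add]
  simp

theorem rescale_coe_polynomial (p : Polynomial ℂ) (c : ℂ) :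
    PowerSeries.rescale c (p : PowerSeries ℂ) =
      ((p.comp (Polynomial.C c * Polynomial.X) : Polynomial ℂ) : PowerSeries ℂ) := by
  refine ((RepresentsEntire.polynomial p).rescale c).unique ?_
  convert! RepresentsEntire.polynomial _ using 2 with z
  simp

/-- On the ray of positive multiples of the conjugate of b the exponential is exp(‖b‖²t), which a
polynomial cannot match unless b = 0. -/
theorem eq_zero_of_eval_mul_exp_eq {p q : Polynomial ℂ} (hp : p ≠ 0) {b : ℂ}
    (h : ∀ z, p.eval z * Complex.exp (b * z) = q.eval z) : b = 0 := by
  by_contra hb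
  have hb' : starRingEnd ℂ b ≠ 0 := by simpa using hb
  obtain ⟨C, hC⟩ := (q.comp (Polynomial.C (starRingEnd ℂ b) * Polynomial.X)).exists_norm_eval_le
  have := Polynomial.nonpos_of_eval_mul_exp_le (Polynomial.comp_C_mul_X_ne_zero hp hb')
    (s := ‖b‖ ^ 2) (C := C)
    (M := (q.comp (Polynomial.C (starRingEnd ℂ b) * Polynomial.X)).natDegree) (fun t ht => ?_)
  · have := norm_pos_iff.2 hb
    nlinarith
  · have h1 := hC t
    rw [Complex.norm_of_nonneg (by linarith)] at h1
    refine le_trans (le_of_eq ?_) h1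
    rw [Polynomial.eval_comp_C_mul_X, Polynomial.eval_comp_C_mul_X, ← h, norm_mul, ← mul_assoc,
      Complex.mul_conj, Complex.norm_exp, Complex.normSq_eq_norm_sq, ← Complex.ofReal_mul,
      Complex.ofReal_re]

/-- The last conclusion is the device for passing to several variables: it recovers a from two
coefficients, which will be polynomials in the direction of the line. -/
theorem exists_eq_polynomial_mul_gaussianSeries (hG : RepresentsEntire G h) (hK : 0 ≤ K)
    (hC : ∀ z, ‖h z‖ ≤ C * Real.exp (K * ‖z‖ ^ 2)) {n : ℕ}
    (hn : PowerSeries.coeff n (G * PowerSeries.rescale Complex.I G) ≠ 0)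
    (hlt : ∀ m, n < m → PowerSeries.coeff m (G * PowerSeries.rescale Complex.I G) = 0) :
    ∃ (a : ℂ) (p : Polynomial ℂ), p ≠ 0 ∧ p.natDegree ≤ n ∧ ‖a‖ ≤ K ∧
      G = (p : PowerSeries ℂ) * gaussianSeries a ∧
      PowerSeries.coeff (n + 1)
        (PowerSeries.derivative ℂ G * PowerSeries.rescale Complex.I G) =
        2 * a * PowerSeries.coeff n (G * PowerSeries.rescale Complex.I G) := by
  set F := G * PowerSeries.rescale Complex.I G with hF
  set q := PowerSeries.trunc (n + 1) F with hq
  have hqF : (q : PowerSeries ℂ) = F := by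
    ext m
    rw [Polynomial.coeff_coe, hq, PowerSeries.coeff_trunc]
    split_ifs with hm
    · rfl
    · rw [hlt m (by omega)]
  have hq0 : q ≠ 0 := fun h0 => hn (by rw [← hqF, h0]; simp)
  have hqdeg : q.natDegree ≤ n := Nat.lt_succ_iff.1 (PowerSeries.natDegree_trunc_lt F n)
  have hhq : ∀ z, h z * h (Complex.I * z) = q.eval z := by
    have h1 := hG.mul (hG.rescale Complex.I)
    rw [← hF, ← hqF] at h1
    exact fun z => (h1 z).unique (RepresentsEntire.polynomial q z)
  have hd := hG.differentiable
  obtain ⟨P, a, b, c, hP⟩ := hd.exists_polynomial_mul_exp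
    (hd.continuous.comp (continuous_const_mul Complex.I)) hq0 hhq hK hC
  obtain ⟨p, hp⟩ : ∃ p, p = Polynomial.C (Complex.exp c) * P := ⟨_, rfl⟩
  have hPp : ∀ z, h z = p.eval z * Complex.exp (b * z) * Complex.exp (a * z ^ 2) := fun z => by
    rw [hP, hp, Polynomial.eval_mul, Polynomial.eval_C, Complex.exp_add, Complex.exp_add]
    ring
  have hp0 : p ≠ 0 := fun h0 => hq0 (Polynomial.funext fun z => by rw [← hhq, hPp, h0]; simp)
  have hpI := Polynomial.comp_C_mul_X_ne_zero hp0 Complex.I_ne_zero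
  have hb : b = 0 := by
    -- In h(z)h(iz) the quadratic exponents cancel and the linear ones add up to b(1 + i)z. The
    -- product is a polynomial, so b(1 + i) = 0.
    have := eq_zero_of_eval_mul_exp_eq (b := b * (1 + Complex.I)) (q := q) (mul_ne_zero hp0 hpI)
      fun z => by
        rw [← hhq, hPp, hPp, Polynomial.eval_mul, Polynomial.eval_comp_C_mul_X, mul_pow,
          Complex.I_sq]
        have e1 : Complex.exp (b * (1 + Complex.I) * z) =
            Complex.exp (b * z) * Complex.exp (b * (Complex.I * z)) := by
          rw [← Complex.exp_add]; ring_nf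
        have e2 : Complex.exp (a * z ^ 2) * Complex.exp (a * (-1 * z ^ 2)) = 1 := by
          rw [← Complex.exp_add]; simp
        rw [e1]
        linear_combination (-p.eval z * p.eval (Complex.I * z) *
          (Complex.exp (b * z) * Complex.exp (b * (Complex.I * z)))) * e2
    rcases mul_eq_zero.1 this with h0 | h0
    · exact h0
    · have := congrArg Complex.re h0
      simp at this
  have hGp : G = (p : PowerSeries ℂ) * gaussianSeries a := by
    refine hG.unique ?_
    convert! (RepresentsEntire.polynomial p).mul (representsEntire_gaussianSeries a) using 2 with z
    rw [hPp, hb]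
    simp
  have hFp : F = ((p * p.comp (Polynomial.C Complex.I * Polynomial.X) : Polynomial ℂ) :
      PowerSeries ℂ) := by
    rw [hF, hGp, map_mul, rescale_coe_polynomial, Polynomial.coe_mul]
    linear_combination ((p : PowerSeries ℂ) *
      (p.comp (Polynomial.C Complex.I * Polynomial.X) : Polynomial ℂ)) *
        gaussianSeries_mul_rescale_I a
  have hqp : q = p * p.comp (Polynomial.C Complex.I * Polynomial.X) :=
    Polynomial.coe_injective ℂ (hqF.trans hFp)
  have hdeg : p.natDegree + (p.comp (Polynomial.C Complex.I * Polynomial.X)).natDegree ≤ n := by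
    rwa [hqp, Polynomial.natDegree_mul hp0 hpI] at hqdeg
  refine ⟨a, p, hp0, by omega, ?_, hGp, ?_⟩
  -- In the direction u the Gaussian factor grows like exp(‖a‖t²), the fastest possible; comparison
  -- with exp(Kt²) gives ‖a‖ ≤ K.
  · obtain ⟨u, hu, hau⟩ : ∃ u : ℂ, ‖u‖ = 1 ∧ a * u ^ 2 = (‖a‖ : ℂ) := by
      refine ⟨Complex.exp (-(a.arg / 2 : ℝ) * Complex.I), ?_, ?_⟩
      · rw [Complex.norm_exp]; simp
      · nth_rw 1 [← Complex.norm_mul_exp_arg_mul_I a]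
        rw [← Complex.exp_nat_mul, mul_assoc, ← Complex.exp_add]
        push_cast
        ring_nf
        simp
    have hu0 : u ≠ 0 := norm_pos_iff.1 (by rw [hu]; exact one_pos)
    refine sub_nonpos.1 (Polynomial.nonpos_of_eval_mul_exp_sq_le
      (Polynomial.comp_C_mul_X_ne_zero hp0 hu0) (C := C) (M := 0) fun t ht => ?_)
    have h1 := hC (u * t)
    have h2 : a * (u * t) ^ 2 = ((‖a‖ * t ^ 2 : ℝ) : ℂ) := by
      push_cast; rw [mul_pow, ← mul_assoc, hau]
    rw [hPp, hb, zero_mul, Complex.exp_zero, mul_one, norm_mul, Complex.norm_exp, norm_mul, hu,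
      Complex.norm_of_nonneg (by linarith), one_mul, h2, Complex.ofReal_re] at h1
    rw [Polynomial.eval_comp_C_mul_X, sub_mul, Real.exp_sub, pow_zero, mul_one, ← mul_div_assoc,
      div_le_iff₀ (Real.exp_pos _)]
    exact h1
  -- With G = p·exp(az²), G′(z)G(iz) = p′(z)p(iz) + 2az·F(z). The first term has degree at most n,
  -- so the coefficient of degree n + 1 comes from the second alone.
  · have hS : PowerSeries.derivative ℂ G * PowerSeries.rescale Complex.I G =
        ((Polynomial.derivative p * p.comp (Polynomial.C Complex.I * Polynomial.X) :
          Polynomial ℂ) : PowerSeries ℂ) + PowerSeries.X * (PowerSeries.C (2 * a) * F) := by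
      rw [hFp, hGp, map_mul (PowerSeries.rescale Complex.I), rescale_coe_polynomial,
        Derivation.leibniz, derivative_gaussianSeries, PowerSeries.derivative_coe,
        Polynomial.coe_mul, Polynomial.coe_mul, smul_eq_mul, smul_eq_mul]
      linear_combination
        (((p.comp (Polynomial.C Complex.I * Polynomial.X) : Polynomial ℂ) : PowerSeries ℂ) *
        (((Polynomial.derivative p : Polynomial ℂ) : PowerSeries ℂ) +
          (p : PowerSeries ℂ) * PowerSeries.C (2 * a) * PowerSeries.X)) *
          gaussianSeries_mul_rescale_I a
    rw [hS, map_add, PowerSeries.coeff_succ_X_mul, PowerSeries.coeff_C_mul, Polynomial.coeff_coe,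
      Polynomial.coeff_eq_zero_of_natDegree_lt, zero_add]
    refine lt_of_le_of_lt (Polynomial.natDegree_mul_le) ?_
    have := Polynomial.natDegree_derivative_le p
    omega

/-- The exponent of an entire function `p(z) exp(a z ^ 2)` which satisfies the cross growth
condition is real. -/
theorem im_eq_zero_of_cross_growth {p : Polynomial ℂ} (hp : p ≠ 0) {a : ℂ} {M : ℕ}
    (hh : ∀ z, h z = p.eval z * Complex.exp (a * z ^ 2))
    (h1 : ∀ (r : ℝ) (w : ℂ), |w.im| ≤ |r| → ‖h r‖ * ‖h w‖ ≤ C * (1 + |r|) ^ M) : a.im = 0 := by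
  -- Take r = t and w = (c + i)t, the edge of the allowed strip. The exponent is t² Re(a + a(c +
  -- i)²), in which the terms ± Re a cancel.
  have key : ∀ c : ℝ, c ^ 2 * a.re - 2 * c * a.im ≤ 0 := by
    intro c
    have hc : (c + Complex.I : ℂ) ≠ 0 := fun h0 => by
      have := congrArg Complex.im h0
      simp at this
    refine Polynomial.nonpos_of_eval_mul_exp_sq_le
      (mul_ne_zero hp (Polynomial.comp_C_mul_X_ne_zero hp hc)) (C := C) (M := M) fun t ht => ?_
    have h2 := h1 t ((c + Complex.I) * t) (by simp)
    rw [abs_of_nonneg (by linarith)] at h2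
    refine le_trans (le_of_eq ?_) h2
    rw [hh, hh, norm_mul, norm_mul, Complex.norm_exp, Complex.norm_exp, Polynomial.eval_mul,
      Polynomial.eval_comp_C_mul_X, norm_mul, mul_mul_mul_comm, ← Real.exp_add]
    congr 2
    simp [pow_two]
    ring
  by_contra him
  -- For c small and of sign opposite to Im a, the linear term dominates and is positive.
  have h2 := key (-(a.im / (|a.re| + 1)))
  have h3 : 0 < |a.re| + 1 := by positivity
  have h4 : 0 < a.im ^ 2 := by positivity
  have h5 : (-(a.im / (|a.re| + 1))) ^ 2 * a.re - 2 * (-(a.im / (|a.re| + 1))) * a.im =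
      a.im ^ 2 / (|a.re| + 1) ^ 2 * (a.re + 2 * (|a.re| + 1)) := by
    field_simp
    ring
  rw [h5] at h2
  have h6 : 0 < a.re + 2 * (|a.re| + 1) := by linarith [neg_abs_le a.re, abs_nonneg a.re]
  exact absurd h2 (not_le.2 (by positivity))

end

/-! ### Polynomials in several variables: density, divisibility, homogeneity -/

namespace MvPolynomial

variable {d : ℕ}

theorem dense_eval_ne_zero {p : MvPolynomial (Fin d) ℂ} (hp : p ≠ 0) :
    Dense {x : Fin d → ℂ | eval x p ≠ 0} := by
  rw [Metric.dense_iff]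
  intro x ε hε
  by_contra hne
  rw [Set.not_nonempty_iff_eq_empty] at hne
  refine hp (funext_set (fun i => Metric.ball (x i) ε)
    (fun i => infinite_of_mem_nhds (x i) (Metric.ball_mem_nhds _ hε)) fun y hy => ?_)
  by_contra h0
  rw [map_zero] at h0
  have : y ∈ Metric.ball x ε ∩ {x : Fin d → ℂ | eval x p ≠ 0} :=
    ⟨by rw [ball_pi _ hε]; exact hy, h0⟩
  simp [hne] at this

theorem dense_eval_ofReal_ne_zero {p : MvPolynomial (Fin d) ℂ} (hp : p ≠ 0) :
    Dense {x : Fin d → ℝ | eval (fun i => (x i : ℂ)) p ≠ 0} := by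
  rw [Metric.dense_iff]
  intro x ε hε
  by_contra hne
  rw [Set.not_nonempty_iff_eq_empty] at hne
  refine hp (funext_set (fun i => Complex.ofReal '' Metric.ball (x i) ε)
    (fun i => (infinite_of_mem_nhds (x i) (Metric.ball_mem_nhds _ hε)).image
      Complex.ofReal_injective.injOn) fun y hy => ?_)
  by_contra h0
  rw [map_zero] at h0
  choose z hz hzy using fun i => hy i (Set.mem_univ i)
  have : z ∈ Metric.ball x ε ∩ {x : Fin d → ℝ | eval (fun i => (x i : ℂ)) p ≠ 0} := by
    refine ⟨by rw [ball_pi _ hε]; exact fun i _ => hz i, ?_⟩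
    simpa [hzy] using h0
  simp [hne] at this

theorem eq_zero_of_eval_ofReal {p : MvPolynomial (Fin d) ℂ}
    (h : ∀ x : Fin d → ℝ, eval (fun i => (x i : ℂ)) p = 0) : p = 0 := by
  by_contra hp
  obtain ⟨x, hx⟩ := (dense_eval_ofReal_ne_zero hp).nonempty
  exact hx (h x)

theorem continuous_eval_ofReal (p : MvPolynomial (Fin d) ℂ) :
    Continuous fun x : Fin d → ℝ => eval (fun i => (x i : ℂ)) p :=
  p.continuous_eval.comp (by fun_prop)

/-- A polynomial which is dominated by another one is divisible by it. -/
theorem dvd_of_norm_eval_le {F : MvPolynomial (Fin d) ℂ} (hF : F ≠ 0)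
    {S : MvPolynomial (Fin d) ℂ} {K : (Fin d → ℂ) → ℝ} (hK : Continuous K)
    (h : ∀ x, ‖eval x S‖ ≤ K x * ‖eval x F‖) : F ∣ S := by
  induction F using WfDvdMonoid.induction_on_irreducible generalizing S K with
  | zero => exact absurd rfl hF
  | unit u hu => exact hu.dvd
  | mul F p hF0 hp ih =>
    have hprime : Prime p := hp.prime
    -- By domination S vanishes on the zero set of p. The ideal of an irreducible p is prime, so the
    -- Nullstellensatz gives p ∣ S.
    have hpS : p ∣ S := by
      have hP : (Ideal.span {p}).IsPrime := (Ideal.span_singleton_prime hp.ne_zero).2 hprime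
      have := MvPolynomial.IsPrime.vanishingIdeal_zeroLocus (K := ℂ) (Ideal.span {p})
      rw [← Ideal.mem_span_singleton, ← this, mem_vanishingIdeal_iff]
      intro x hx
      rw [zeroLocus_span] at hx
      have hx' : eval x p = 0 := by simpa using hx
      have h1 := h x
      rw [map_mul, hx', zero_mul, norm_zero, mul_zero] at h1
      simpa [coe_aeval_eq_eval] using norm_le_zero_iff.1 h1
    obtain ⟨S₁, rfl⟩ := hpS
    refine mul_dvd_mul_left p (ih hF0 hK fun x => ?_)
    -- The common factor p cancels from the inequality where it is nonzero; density and continuity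
    -- extend the result.
    refine (dense_eval_ne_zero hp.ne_zero).induction (P := fun x => ‖eval x S₁‖ ≤ K x * ‖eval x F‖)
      (fun x hx => ?_) (isClosed_le S₁.continuous_eval.norm (hK.mul F.continuous_eval.norm)) x
    have h1 := h x
    rw [map_mul, map_mul, norm_mul, norm_mul, mul_left_comm] at h1
    exact le_of_mul_le_mul_left h1 (norm_pos_iff.2 hx)

theorem IsHomogeneous.eval_smul_eq {p : MvPolynomial (Fin d) ℂ} {k : ℕ} (hp : p.IsHomogeneous k)
    (t : ℂ) (x : Fin d → ℂ) : eval (t • x) p = t ^ k * eval x p := by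
  rw [eval_eq', eval_eq', Finset.mul_sum]
  refine Finset.sum_congr rfl fun m hm => ?_
  have h1 : ∑ i, m i = k := by
    by_contra hne
    refine mem_support_iff.1 hm (hp.coeff_eq_zero ?_)
    rwa [Finsupp.degree_eq_sum]
  simp only [Pi.smul_apply, smul_eq_mul, mul_pow, Finset.prod_mul_distrib,
    Finset.prod_pow_eq_pow_sum, h1]
  ring

theorem exists_quadratic_of_eval_smul {Q : MvPolynomial (Fin d) ℂ}
    (h : ∀ (t : ℂ) (x : Fin d → ℂ), eval (t • x) Q = t ^ 2 * eval x Q) :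
    ∃ B : Matrix (Fin d) (Fin d) ℂ, ∀ x, eval x Q = ∑ i, ∑ j, B i j * x i * x j := by
  have hcomp : ∀ x, eval x Q = eval x (homogeneousComponent 2 Q) := by
    intro x
    set q : Polynomial ℂ := ∑ k ∈ Finset.range (Q.totalDegree + 1),
      Polynomial.C (eval x (homogeneousComponent k Q)) * Polynomial.X ^ k with hq
    have h1 : q = Polynomial.C (eval x Q) * Polynomial.X ^ 2 := by
      refine Polynomial.funext fun t => ?_
      simp only [hq, Polynomial.eval_finsetSum, Polynomial.eval_mul, Polynomial.eval_C,
        Polynomial.eval_pow, Polynomial.eval_X]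
      rw [mul_comm (eval x Q), ← h]
      conv_rhs => rw [← sum_homogeneousComponent Q, map_sum]
      refine Finset.sum_congr rfl fun k _ => ?_
      rw [(homogeneousComponent_isHomogeneous k Q).eval_smul_eq, mul_comm]
    have h2 := congrArg (fun q => q.coeff 2) h1
    simp only [hq, Polynomial.finsetSum_coeff, Polynomial.coeff_C_mul, Polynomial.coeff_X_pow,
      mul_ite, mul_one, mul_zero, if_true] at h2
    rw [← h2]
    simp only [Finset.sum_ite_eq, Finset.mem_range]
    split_ifs with hlt
    · rfl
    · rw [homogeneousComponent_eq_zero _ _ (by omega), map_zero]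
  have hQ2 := homogeneousComponent_isHomogeneous 2 Q
  set R := homogeneousComponent 2 Q
  have hc : ∀ i j, pderiv j (pderiv i R) = C (coeff 0 (pderiv j (pderiv i R))) := fun i j => by
    have h0 : (pderiv j (pderiv i R)).IsHomogeneous 0 := (hQ2.pderiv (i := i)).pderiv
    exact totalDegree_eq_zero_iff_eq_C.1 ((totalDegree_zero_iff_isHomogeneous _).2 h0)
  -- Half the Hessian of the degree-two component, whose second derivatives are constants; Euler's
  -- identity is applied twice.
  refine ⟨Matrix.of fun i j => coeff 0 (pderiv j (pderiv i R)) / 2, fun x => ?_⟩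
  have e1 := congrArg (eval x) hQ2.sum_X_mul_pderiv
  have e2 : ∀ i, ∑ j, x j * coeff 0 (pderiv j (pderiv i R)) = eval x (pderiv i R) := fun i => by
    have h1 := congrArg (eval x) (hQ2.pderiv (i := i)).sum_X_mul_pderiv
    simp only [Nat.add_one_sub_one, one_smul] at h1
    rw [← h1, map_sum]
    refine Finset.sum_congr rfl fun j _ => ?_
    rw [map_mul, eval_X, hc, eval_C]
    simp
  rw [map_sum, map_nsmul] at e1
  simp only [map_mul, eval_X, ← e2, nsmul_eq_mul, Nat.cast_ofNat] at e1
  rw [hcomp, ← mul_right_inj' (two_ne_zero' ℂ), ← e1, Finset.mul_sum]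
  refine Finset.sum_congr rfl fun i _ => ?_
  rw [Finset.mul_sum, Finset.mul_sum]
  refine Finset.sum_congr rfl fun j _ => ?_
  rw [Matrix.of_apply]
  ring

end MvPolynomial

/-! ### From complex lines to ℂ^d -/

theorem PowerSeries.map_derivative {R S : Type*} [CommSemiring R] [CommSemiring S] (f : R →+* S)
    (A : PowerSeries R) :
    PowerSeries.map f (PowerSeries.derivative R A) = PowerSeries.derivative S (PowerSeries.map f A) := by
  ext n
  simp [PowerSeries.coeff_derivative]

theorem PowerSeries.derivative_rescale {R : Type*} [CommSemiring R] (r : R) (A : PowerSeries R) :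
    PowerSeries.derivative R (PowerSeries.rescale r A) =
      PowerSeries.C r * PowerSeries.rescale r (PowerSeries.derivative R A) := by
  ext n
  simp only [PowerSeries.coeff_derivative, PowerSeries.coeff_rescale, PowerSeries.coeff_C_mul]
  ring

namespace MvPolynomial

variable {d : ℕ} {g : (Fin d → ℂ) → ℂ} {G : PowerSeries (MvPolynomial (Fin d) ℂ)}

theorem map_eval_smul (hG : ∀ x, RepresentsEntire (PowerSeries.map (eval x) G) (fun z => g (z • x)))
    (t : ℂ) (x : Fin d → ℂ) :
    PowerSeries.map (eval (t • x)) G = PowerSeries.rescale t (PowerSeries.map (eval x) G) := by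
  refine (hG (t • x)).unique ?_
  convert! (hG x).rescale t using 2 with z
  rw [smul_smul, mul_comm]

/-- A nonzero function on `ℂ ^ d`, entire of order at most two along lines, which satisfies the
cross growth condition on real lines is a polynomial times the exponential of a quadratic form
which is real on `ℝ ^ d`. -/
theorem exists_eq_polynomial_mul_exp
    (hG : ∀ x, RepresentsEntire (PowerSeries.map (eval x) G) (fun z => g (z • x)))
    (hG0 : G ≠ 0) {C K : ℝ} (hK : 0 ≤ K)
    (hC : ∀ x, ‖g x‖ ≤ C * Real.exp (K * (∑ i, ‖x i‖) ^ 2)) {M : ℕ}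
    (hcross : ∀ x : Fin d → ℝ, ∃ C : ℝ, ∀ (r : ℝ) (w : ℂ), |w.im| ≤ |r| →
      ‖g ((r : ℂ) • fun i => (x i : ℂ))‖ * ‖g (w • fun i => (x i : ℂ))‖ ≤ C * (1 + |r|) ^ M) :
    ∃ (T Q : MvPolynomial (Fin d) ℂ),
      (∀ (t : ℂ) (x : Fin d → ℂ), eval (t • x) Q = t ^ 2 * eval x Q) ∧
      (∀ x : Fin d → ℝ, (eval (fun i => (x i : ℂ)) Q).im = 0) ∧
      ∀ x, g x = eval x T * Complex.exp (eval x Q) := by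
  classical
  set F := G * PowerSeries.rescale (MvPolynomial.C Complex.I) G with hFdef
  set S := PowerSeries.derivative _ G * PowerSeries.rescale (MvPolynomial.C Complex.I) G with hSdef
  have hFx : ∀ x, PowerSeries.map (eval x) F = PowerSeries.map (eval x) G *
      PowerSeries.rescale Complex.I (PowerSeries.map (eval x) G) := fun x => by
    rw [hFdef, map_mul, ← PowerSeries.rescale_map, eval_C]
  have hSx : ∀ x, PowerSeries.map (eval x) S =
      PowerSeries.derivative ℂ (PowerSeries.map (eval x) G) *
      PowerSeries.rescale Complex.I (PowerSeries.map (eval x) G) := fun x => by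
    rw [hSdef, map_mul, ← PowerSeries.rescale_map, eval_C, PowerSeries.map_derivative]
  have hgrow : ∀ (x : Fin d → ℂ) (z : ℂ), ‖g (z • x)‖ ≤ C * Real.exp ((K * (∑ i, ‖x i‖) ^ 2) * ‖z‖ ^ 2) := by
    intro x z
    refine (hC _).trans (le_of_eq ?_)
    simp only [Pi.smul_apply, smul_eq_mul, norm_mul, ← Finset.mul_sum]
    ring_nf
  have hF0 : F ≠ 0 := by
    refine mul_ne_zero hG0 fun h0 => hG0 ?_
    ext1 n
    have h1 := congrArg (PowerSeries.coeff n) h0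
    rw [PowerSeries.coeff_rescale, map_zero, ← map_pow] at h1
    rcases mul_eq_zero.1 h1 with h2 | h2
    · exact absurd h2 (by simp)
    · rw [h2, map_zero]
  -- The growth condition is available on real lines only, but a polynomial vanishing on ℝ^d is
  -- zero. The exponent M has to be the same for all lines; the constant need not be.
  have hFM : ∀ k, M < k → PowerSeries.coeff k F = 0 := by
    intro k hk
    refine eq_zero_of_eval_ofReal fun x => ?_
    obtain ⟨C', hC'⟩ := hcross x
    have h1 := (hG fun i => (x i : ℂ)).mul ((hG fun i => (x i : ℂ)).rescale Complex.I)
    rw [← hFx] at h1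
    rw [← PowerSeries.coeff_map]
    exact h1.coeff_eq_zero_of_growth (norm_mul_rotate_le (hG fun i => (x i : ℂ)).differentiable
      (hgrow _) hC') hk
  obtain ⟨n, hn, hlt⟩ : ∃ n, PowerSeries.coeff n F ≠ 0 ∧ ∀ m, n < m → PowerSeries.coeff m F = 0 := by
    obtain ⟨k, hk⟩ : ∃ k, PowerSeries.coeff k F ≠ 0 := by
      by_contra! h
      exact hF0 (PowerSeries.ext fun k => by simpa using h k)
    have hkM : k ≤ M := not_lt.1 fun h => hk (hFM k h)
    refine ⟨Nat.findGreatest (fun k => PowerSeries.coeff k F ≠ 0) M,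
      Nat.findGreatest_spec (P := fun k => PowerSeries.coeff k F ≠ 0) hkM hk, fun m hm => ?_⟩
    by_cases hmM : m ≤ M
    · by_contra h0
      exact Nat.findGreatest_is_greatest hm hmM h0
    · exact hFM m (not_le.1 hmM)
  set Fn := PowerSeries.coeff n F with hFn
  set Sn := PowerSeries.coeff (n + 1) S with hSn
  have hFnx : ∀ x, eval x Fn = PowerSeries.coeff n (PowerSeries.map (eval x) G *
      PowerSeries.rescale Complex.I (PowerSeries.map (eval x) G)) := fun x => by
    rw [← hFx, PowerSeries.coeff_map]
  have hSnx : ∀ x, eval x Sn = PowerSeries.coeff (n + 1)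
      (PowerSeries.derivative ℂ (PowerSeries.map (eval x) G) *
      PowerSeries.rescale Complex.I (PowerSeries.map (eval x) G)) := fun x => by
    rw [← hSx, PowerSeries.coeff_map]
  have hline : ∀ x, eval x Fn ≠ 0 → ∃ (a : ℂ) (p : Polynomial ℂ), p ≠ 0 ∧ p.natDegree ≤ n ∧
      ‖a‖ ≤ K * (∑ i, ‖x i‖) ^ 2 ∧
      PowerSeries.map (eval x) G = (p : PowerSeries ℂ) * gaussianSeries a ∧
      eval x Sn = 2 * a * eval x Fn := by
    intro x hx
    rw [hFnx, hSnx]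
    rw [hFnx] at hx
    refine exists_eq_polynomial_mul_gaussianSeries (hG x) (by positivity) (hgrow x) hx fun m hm => ?_
    rw [← hFx, PowerSeries.coeff_map, hlt m hm, map_zero]
  have hKcont : Continuous fun x : Fin d → ℂ => 2 * (K * (∑ i, ‖x i‖) ^ 2) := by fun_prop
  -- Where Fn ≠ 0, Sn = 2a·Fn with |a| bounded by a continuous function of x. Hence Fn dominates Sn
  -- everywhere and divides it, so the exponent a(x) is a polynomial.
  have hdvd : Fn ∣ Sn := by
    refine dvd_of_norm_eval_le hn hKcont fun x => ?_
    refine (dense_eval_ne_zero hn).induction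
      (P := fun x => ‖eval x Sn‖ ≤ 2 * (K * (∑ i, ‖x i‖) ^ 2) * ‖eval x Fn‖)
      (fun x hx => ?_)
      (isClosed_le Sn.continuous_eval.norm (hKcont.mul Fn.continuous_eval.norm)) x
    obtain ⟨a, p, -, -, ha, -, hS⟩ := hline x hx
    rw [hS, norm_mul, norm_mul, Complex.norm_ofNat]
    gcongr
  obtain ⟨R, hR⟩ := hdvd
  set Q := MvPolynomial.C (1 / 2 : ℂ) * R with hQdef
  have hSQ : ∀ x, eval x Sn = 2 * eval x Q * eval x Fn := fun x => by
    rw [hR, hQdef]; simp; ring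
  have hlineQ : ∀ x, eval x Fn ≠ 0 → ∃ p : Polynomial ℂ, p ≠ 0 ∧ p.natDegree ≤ n ∧
      PowerSeries.map (eval x) G = (p : PowerSeries ℂ) * gaussianSeries (eval x Q) := by
    intro x hx
    obtain ⟨a, p, hp, hpn, -, hGp, hS⟩ := hline x hx
    rw [hSQ] at hS
    have : eval x Q = a := by
      have := mul_right_cancel₀ hx hS
      simpa using this
    exact ⟨p, hp, hpn, this ▸ hGp⟩
  -- Scaling x by t rescales the series, so Fn is homogeneous of degree n. Sn has degree n + 2: n +
  -- 1 from the index of the coefficient and one more from the derivative.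
  have hhomne : ∀ (t : ℂ), t ≠ 0 → ∀ x : Fin d → ℂ, eval (t • x) Q = t ^ 2 * eval x Q := by
    intro t ht x
    have hFt : ∀ x, eval (t • x) Fn = t ^ n * eval x Fn := fun x => by
      have hcomm : PowerSeries.rescale Complex.I (PowerSeries.rescale t (PowerSeries.map (eval x) G)) =
          PowerSeries.rescale t (PowerSeries.rescale Complex.I (PowerSeries.map (eval x) G)) := by
        rw [PowerSeries.rescale_rescale, PowerSeries.rescale_rescale, mul_comm]
      rw [hFnx, hFnx, map_eval_smul hG, hcomm, ← map_mul, PowerSeries.coeff_rescale]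
    have hSt : ∀ x, eval (t • x) Sn = t ^ (n + 2) * eval x Sn := fun x => by
      have hcomm : PowerSeries.rescale Complex.I (PowerSeries.rescale t (PowerSeries.map (eval x) G)) =
          PowerSeries.rescale t (PowerSeries.rescale Complex.I (PowerSeries.map (eval x) G)) := by
        rw [PowerSeries.rescale_rescale, PowerSeries.rescale_rescale, mul_comm]
      rw [hSnx, hSnx, map_eval_smul hG, hcomm, PowerSeries.derivative_rescale, mul_assoc, ← map_mul,
        PowerSeries.coeff_C_mul, PowerSeries.coeff_rescale]
      ring
    have hcont : Continuous fun x : Fin d → ℂ => eval (t • x) Q :=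
      Q.continuous_eval.comp (continuous_const_smul t)
    refine (dense_eval_ne_zero hn).induction (P := fun x => eval (t • x) Q = t ^ 2 * eval x Q)
      (fun x hx => ?_) (isClosed_eq hcont (Q.continuous_eval.const_mul _)) x
    have h1 := hSt x
    rw [hSQ, hSQ, hFt] at h1
    have h2 : (2 * t ^ n * eval x Fn) ≠ 0 :=
      mul_ne_zero (mul_ne_zero two_ne_zero (pow_ne_zero _ ht)) hx
    refine mul_left_cancel₀ h2 ?_
    linear_combination h1
  have hhom : ∀ (t : ℂ) (x : Fin d → ℂ), eval (t • x) Q = t ^ 2 * eval x Q := by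
    intro t x
    -- For t = 0 the value at the origin must vanish: homogeneity with t = 2 gives Q(0) = 4Q(0).
    rcases eq_or_ne t 0 with rfl | ht
    · have := hhomne 2 two_ne_zero 0
      rw [smul_zero] at this
      rw [zero_smul]
      linear_combination (-1 / 3 : ℂ) * this
    · exact hhomne t ht x
  -- Removing the Gaussian leaves the polynomial p on generic lines. Its degree is at most n
  -- uniformly, so T terminates and its sum is a polynomial in x.
  set T := G * gaussianSeries (-Q) with hTdef
  have hTx : ∀ x, PowerSeries.map (eval x) T =
      PowerSeries.map (eval x) G * gaussianSeries (-eval x Q) := fun x => by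
    rw [hTdef, map_mul, map_gaussianSeries, map_neg]
  have hgg : ∀ a : ℂ, gaussianSeries a * gaussianSeries (-a) = 1 := fun a => by
    refine ((representsEntire_gaussianSeries a).mul (representsEntire_gaussianSeries (-a))).unique ?_
    have h1 := RepresentsEntire.polynomial 1
    rw [Polynomial.coe_one] at h1
    convert! h1 using 2 with z
    rw [← Complex.exp_add]
    simp
  have hTn : ∀ k, n < k → PowerSeries.coeff k T = 0 := by
    intro k hk
    have hzero : ∀ x, eval x (PowerSeries.coeff k T) = 0 := by
      refine fun x => (dense_eval_ne_zero hn).induction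
        (P := fun x => eval x (PowerSeries.coeff k T) = 0)
        (fun x hx => ?_) (isClosed_eq (MvPolynomial.continuous_eval _) continuous_const) x
      obtain ⟨p, -, hpn, hGp⟩ := hlineQ x hx
      rw [← PowerSeries.coeff_map, hTx, hGp, mul_assoc, hgg, mul_one, Polynomial.coeff_coe]
      exact Polynomial.coeff_eq_zero_of_natDegree_lt (by omega)
    exact MvPolynomial.funext fun x => by rw [hzero, map_zero]
  refine ⟨∑ k ∈ Finset.range (n + 1), PowerSeries.coeff k T, Q, hhom, ?_, fun x => ?_⟩
  · intro x
    refine (dense_eval_ofReal_ne_zero hn).induction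
      (P := fun x => (eval (fun i => (x i : ℂ)) Q).im = 0)
      (fun x hx => ?_)
      (isClosed_eq (Complex.continuous_im.comp (continuous_eval_ofReal Q)) continuous_const) x
    obtain ⟨p, hp, -, hGp⟩ := hlineQ _ hx
    obtain ⟨C', hC'⟩ := hcross x
    refine im_eq_zero_of_cross_growth
      (h := fun z : ℂ => g (z • fun i => (x i : ℂ))) hp (fun z => ?_) hC'
    have h1 := (RepresentsEntire.polynomial p).mul
      (representsEntire_gaussianSeries (eval (fun i => (x i : ℂ)) Q))
    rw [← hGp] at h1
    exact (hG _ z).unique (h1 z)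
  · have h1 := (hG x).mul (representsEntire_gaussianSeries (-eval x Q)) 1
    rw [← hTx] at h1
    have h2 := hasSum_sum_of_ne_finset_zero (L := SummationFilter.unconditional ℕ)
      (s := Finset.range (n + 1))
      (f := fun k => PowerSeries.coeff k (PowerSeries.map (eval x) T) * 1 ^ k) fun k hk => by
        rw [PowerSeries.coeff_map, hTn k (not_le.1 fun h => hk (Finset.mem_range.2 (by omega))),
          map_zero, zero_mul]
    have h3 := h1.unique h2
    simp only [one_smul, one_pow, mul_one, PowerSeries.coeff_map] at h3
    rw [map_sum, ← h3, mul_assoc, ← Complex.exp_add, neg_add_cancel, Complex.exp_zero, mul_one]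

end MvPolynomial

/-! ### The L² Fourier transform on L¹ ∩ L² -/

section FourierLp

variable {E : Type*} [NormedAddCommGroup E] [InnerProductSpace ℝ E] [FiniteDimensional ℝ E]
  [MeasurableSpace E] [BorelSpace E]

theorem integral_fourier_mul_eq {f g : E → ℂ} (hf : Integrable f) (hg : Integrable g) :
    ∫ x, 𝓕 f x * g x = ∫ x, f x * 𝓕 g x := by
  have := VectorFourier.integral_fourierIntegral_smul_eq_flip (μ := volume) (ν := volume)
    (L := innerₗ E) (e := Real.fourierChar) Real.continuous_fourierChar continuous_inner hf hg
  rw [flip_innerₗ] at this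
  exact this

theorem continuous_fourier {f : E → ℂ} (hf : Integrable f) : Continuous (𝓕 f) :=
  VectorFourier.fourierIntegral_continuous Real.continuous_fourierChar
    (L := innerₗ E) continuous_inner hf

/-- On `L¹ ∩ L²` the `L²` Fourier transform is given by the Fourier integral. -/
theorem fourier_toLp_ae_eq {f : E → ℂ} (h1 : Integrable f) (h2 : MemLp f 2) :
    (𝓕 (h2.toLp f) : Lp ℂ 2 (volume : Measure E)) =ᵐ[volume] 𝓕 f := by
  refine ae_eq_of_integral_contDiff_smul_eq
    ((Lp.memLp _).locallyIntegrable (by norm_num)) (continuous_fourier h1).locallyIntegrable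
    fun g hg hgs => ?_
  have hgC : ContDiff ℝ (⊤ : ℕ∞) (fun x => (g x : ℂ)) := Complex.ofRealCLM.contDiff.comp hg
  have hgsC : HasCompactSupport (fun x => (g x : ℂ)) := hgs.comp_left Complex.ofReal_zero
  set φ := hgsC.toSchwartzMap hgC with hφ
  have hφx : ∀ x, φ x = (g x : ℂ) := fun x => rfl
  -- Both transforms are tested against smooth compactly supported functions: the L² one as a
  -- tempered distribution, the integral one by the multiplication formula.
  have key := congrArg (fun T => T φ) (Lp.fourier_toTemperedDistribution_eq (h2.toLp f))
  simp only [TemperedDistribution.fourier_apply, Lp.toTemperedDistribution_apply] at key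
  have e1 : ∀ x, g x • (𝓕 (h2.toLp f) : Lp ℂ 2 (volume : Measure E)) x =
      φ x • (𝓕 (h2.toLp f) : Lp ℂ 2 (volume : Measure E)) x := fun x => by
    rw [hφx]; simp
  have e2 : ∀ x, g x • 𝓕 f x = φ x * 𝓕 f x := fun x => by rw [hφx]; simp
  simp only [e1, e2]
  rw [← key, ← integral_fourier_mul_eq φ.integrable h1, ← SchwartzMap.fourier_coe]
  refine integral_congr_ae ?_
  filter_upwards [h2.coeFn_toLp] with x hx
  rw [hx, smul_eq_mul]

end FourierLp

/-! ### Polynomials times Gaussians: positive definite matrices, decay, Fourier transforms -/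

theorem exists_one_add_pow_mul_exp_neg_sq_le (M : ℕ) {c : ℝ} (hc : 0 < c) :
    ∃ C : ℝ, 0 ≤ C ∧ ∀ r : ℝ, 0 ≤ r → (1 + r) ^ M * Real.exp (-(c * r ^ 2)) ≤ C := by
  -- (1 + r)^M ≤ M!·exp(1 + r), and 1/(4c) is the maximum of r - cr².
  refine ⟨M.factorial * Real.exp (1 + 1 / (4 * c)), by positivity, fun r hr => ?_⟩
  have h1 := Real.pow_div_factorial_le_exp (x := 1 + r) (by linarith) M
  rw [div_le_iff₀ (by positivity)] at h1
  calc (1 + r) ^ M * Real.exp (-(c * r ^ 2))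
      ≤ Real.exp (1 + r) * M.factorial * Real.exp (-(c * r ^ 2)) := by gcongr
    _ = M.factorial * Real.exp (1 + r + -(c * r ^ 2)) := by rw [Real.exp_add (1 + r)]; ring
    _ ≤ _ := by
      refine mul_le_mul_of_nonneg_left (Real.exp_le_exp.2 ?_) (by positivity)
      have : r - c * r ^ 2 ≤ 1 / (4 * c) := by
        rw [le_div_iff₀ (by positivity)]
        nlinarith [sq_nonneg (2 * c * r - 1)]
      linarith

theorem MvPolynomial.exists_norm_eval_le {d : ℕ} (P : MvPolynomial (Fin d) ℂ) :
    ∃ (C : ℝ) (M : ℕ), 0 ≤ C ∧ ∀ x : EuclideanSpace ℝ (Fin d),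
      ‖MvPolynomial.eval (fun i => (x i : ℂ)) P‖ ≤ C * (1 + ‖x‖) ^ M := by
  induction P using MvPolynomial.induction_on with
  | C a => exact ⟨‖a‖, 0, norm_nonneg _, fun x => by simp⟩
  | add p q hp hq =>
    obtain ⟨C₁, M₁, h₁, hp⟩ := hp
    obtain ⟨C₂, M₂, h₂, hq⟩ := hq
    refine ⟨C₁ + C₂, M₁ + M₂, add_nonneg h₁ h₂, fun x => ?_⟩
    have hx := norm_nonneg x
    rw [map_add, add_mul]
    refine (norm_add_le _ _).trans (add_le_add ((hp x).trans ?_) ((hq x).trans ?_))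
    · gcongr <;> linarith
    · gcongr <;> linarith
  | mul_X p i hp =>
    obtain ⟨C, M, h, hp⟩ := hp
    refine ⟨C, M + 1, h, fun x => ?_⟩
    have hx := norm_nonneg x
    rw [map_mul, norm_mul, MvPolynomial.eval_X, pow_succ, ← mul_assoc, Complex.norm_real]
    have := PiLp.norm_apply_le x i
    exact mul_le_mul (hp x) (by linarith) (norm_nonneg _) (by positivity)

namespace Matrix

variable {d : ℕ} {A : Matrix (Fin d) (Fin d) ℝ}

theorem PosDef.exists_eq_transpose_mul_self (hA : A.PosDef) :
    ∃ L : Matrix (Fin d) (Fin d) ℝ, IsUnit L.det ∧ A = Lᵀ * L := by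
  open scoped MatrixOrder in
  obtain ⟨L, hL⟩ := CStarAlgebra.nonneg_iff_eq_star_mul_self.mp hA.posSemidef.nonneg
  rw [star_eq_conjTranspose, conjTranspose_eq_transpose_of_trivial] at hL
  refine ⟨L, ?_, hL⟩
  have := hA.det_pos.ne'
  rw [hL, det_mul] at this
  exact isUnit_iff_ne_zero.2 (right_ne_zero_of_mul this)

theorem dotProduct_transpose_mul_self_mulVec (L : Matrix (Fin d) (Fin d) ℝ)
    (x : EuclideanSpace ℝ (Fin d)) :
    ((Lᵀ * L) *ᵥ x.ofLp) ⬝ᵥ x.ofLp = ‖(WithLp.toLp 2 (L *ᵥ x.ofLp) : EuclideanSpace ℝ (Fin d))‖ ^ 2 := by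
  rw [← real_inner_self_eq_norm_sq, EuclideanSpace.inner_eq_star_dotProduct, star_trivial,
    ← mulVec_mulVec, mulVec_transpose, ← dotProduct_mulVec]

theorem PosDef.exists_mul_sq_le (hA : A.PosDef) :
    ∃ c : ℝ, 0 < c ∧ ∀ x : EuclideanSpace ℝ (Fin d), c * ‖x‖ ^ 2 ≤ (A *ᵥ x.ofLp) ⬝ᵥ x.ofLp := by
  obtain ⟨L, hL, rfl⟩ := hA.exists_eq_transpose_mul_self
  set T := (Matrix.toLpLin 2 2 L⁻¹).toContinuousLinearMap with hT
  refine ⟨1 / (‖T‖ + 1) ^ 2, by positivity, fun x => ?_⟩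
  rw [dotProduct_transpose_mul_self_mulVec]
  set y : EuclideanSpace ℝ (Fin d) := WithLp.toLp 2 (L *ᵥ x.ofLp) with hy
  have hx : T y = x := by
    have : L⁻¹ * L = 1 := nonsing_inv_mul L hL
    simp [hT, hy, toLpLin_apply, mulVec_mulVec, this]
  have h1 : ‖x‖ ≤ (‖T‖ + 1) * ‖y‖ := by
    have := T.le_opNorm y
    rw [hx] at this
    nlinarith [norm_nonneg y]
  rw [div_mul_eq_mul_div, one_mul, div_le_iff₀ (by positivity), ← mul_pow, mul_comm]
  gcongr

/-- The Fenchel inequality for the quadratic forms of a matrix and its inverse. -/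
theorem PosDef.two_mul_abs_inner_le (hA : A.PosDef) (x y : EuclideanSpace ℝ (Fin d)) :
    2 * |inner ℝ x y| ≤ (A *ᵥ x.ofLp) ⬝ᵥ x.ofLp + (A⁻¹ *ᵥ y.ofLp) ⬝ᵥ y.ofLp := by
  obtain ⟨L, hL, rfl⟩ := hA.exists_eq_transpose_mul_self
  have hinv : (Lᵀ * L)⁻¹ = (L⁻¹ᵀ)ᵀ * L⁻¹ᵀ := by
    rw [mul_inv_rev, transpose_transpose, transpose_nonsing_inv]
  rw [hinv, dotProduct_transpose_mul_self_mulVec, dotProduct_transpose_mul_self_mulVec]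
  set u : EuclideanSpace ℝ (Fin d) := WithLp.toLp 2 (L *ᵥ x.ofLp)
  set w : EuclideanSpace ℝ (Fin d) := WithLp.toLp 2 (L⁻¹ᵀ *ᵥ y.ofLp)
  have h : inner ℝ x y = inner ℝ u w := by
    have h1 : L⁻¹ * L = 1 := nonsing_inv_mul L hL
    rw [EuclideanSpace.inner_eq_star_dotProduct, EuclideanSpace.inner_eq_star_dotProduct,
      star_trivial, star_trivial]
    change _ = (L⁻¹ᵀ *ᵥ y.ofLp) ⬝ᵥ (L *ᵥ x.ofLp)
    rw [mulVec_transpose, ← dotProduct_mulVec, mulVec_mulVec, h1, one_mulVec]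
  rw [h]
  nlinarith [abs_real_inner_le_norm u w, sq_nonneg (‖u‖ - ‖w‖)]

end Matrix

section PolyGaussian

variable {d : ℕ} {A : Matrix (Fin d) (Fin d) ℝ}

theorem continuous_eval_coe (P : MvPolynomial (Fin d) ℂ) :
    Continuous fun x : EuclideanSpace ℝ (Fin d) => MvPolynomial.eval (fun i => (x i : ℂ)) P :=
  P.continuous_eval.comp (by fun_prop)

theorem continuous_quadraticForm (A : Matrix (Fin d) (Fin d) ℝ) :
    Continuous fun x : EuclideanSpace ℝ (Fin d) => (A *ᵥ x.ofLp) ⬝ᵥ x.ofLp := by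
  simp only [Matrix.mulVec, dotProduct]
  fun_prop

theorem continuous_polyGaussian (P : MvPolynomial (Fin d) ℂ) (A : Matrix (Fin d) (Fin d) ℝ) :
    Continuous (polyGaussian P A) := by
  unfold polyGaussian
  have := continuous_quadraticForm A
  exact (continuous_eval_coe P).mul (by fun_prop)

theorem norm_polyGaussian (P : MvPolynomial (Fin d) ℂ) (A : Matrix (Fin d) (Fin d) ℝ) (x : EuclideanSpace ℝ (Fin d)) :
    ‖polyGaussian P A x‖ = ‖MvPolynomial.eval (fun i => (x i : ℂ)) P‖ *
      Real.exp (-Real.pi * ((A *ᵥ x.ofLp) ⬝ᵥ x.ofLp)) := by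
  rw [polyGaussian, norm_mul, Complex.norm_of_nonneg (Real.exp_pos _).le]

theorem exists_norm_polyGaussian_le (P : MvPolynomial (Fin d) ℂ) (hA : A.PosDef) (N : ℕ) :
    ∃ C : ℝ, 0 ≤ C ∧ ∀ x : EuclideanSpace ℝ (Fin d), ‖polyGaussian P A x‖ ≤ C * (1 + ‖x‖) ^ (-(N : ℝ)) := by
  obtain ⟨C₁, M, h₁, hP⟩ := P.exists_norm_eval_le
  obtain ⟨c, hc, hAc⟩ := hA.exists_mul_sq_le
  obtain ⟨C₂, h₂, hC⟩ := exists_one_add_pow_mul_exp_neg_sq_le (M + N) (mul_pos Real.pi_pos hc)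
  refine ⟨C₁ * C₂, mul_nonneg h₁ h₂, fun x => ?_⟩
  have hx := norm_nonneg x
  rw [norm_polyGaussian, Real.rpow_neg (by positivity), Real.rpow_natCast, ← div_eq_mul_inv,
    le_div_iff₀ (by positivity)]
  have h3 : Real.exp (-Real.pi * ((A *ᵥ x.ofLp) ⬝ᵥ x.ofLp)) ≤
      Real.exp (-(Real.pi * c * ‖x‖ ^ 2)) := by
    refine Real.exp_le_exp.2 ?_
    have := mul_le_mul_of_nonneg_left (hAc x) Real.pi_pos.le
    linarith
  calc ‖MvPolynomial.eval (fun i => (x i : ℂ)) P‖ *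
        Real.exp (-Real.pi * ((A *ᵥ x.ofLp) ⬝ᵥ x.ofLp)) * (1 + ‖x‖) ^ N
      ≤ (C₁ * (1 + ‖x‖) ^ M) * Real.exp (-(Real.pi * c * ‖x‖ ^ 2)) * (1 + ‖x‖) ^ N := by
        gcongr
        exact hP x
    _ = C₁ * ((1 + ‖x‖) ^ (M + N) * Real.exp (-(Real.pi * c * ‖x‖ ^ 2))) := by
        rw [pow_add]; ring
    _ ≤ _ := mul_le_mul_of_nonneg_left (hC _ hx) h₁

theorem integrable_polyGaussian (P : MvPolynomial (Fin d) ℂ) (hA : A.PosDef) :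
    Integrable (polyGaussian P A) := by
  obtain ⟨C, -, hC⟩ := exists_norm_polyGaussian_le P hA (d + 1)
  refine Integrable.mono' ((integrable_one_add_norm (μ := volume) (E := EuclideanSpace ℝ (Fin d))
    (r := ((d + 1 : ℕ) : ℝ)) ?_).const_mul C) (continuous_polyGaussian P A).aestronglyMeasurable
    (Filter.Eventually.of_forall hC)
  simp

theorem memLp_polyGaussian (P : MvPolynomial (Fin d) ℂ) (hA : A.PosDef) :
    MemLp (polyGaussian P A) 2 := by
  obtain ⟨C, h, hC⟩ := exists_norm_polyGaussian_le P hA 0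
  have hm := (continuous_polyGaussian P A).aestronglyMeasurable (μ := volume)
  rw [memLp_two_iff_integrable_sq_norm hm]
  refine ((integrable_polyGaussian P hA).norm.const_mul C).mono' (hm.norm.pow 2)
    (Filter.Eventually.of_forall fun x => ?_)
  have := hC x
  simp only [CharP.cast_eq_zero, neg_zero, Real.rpow_zero, mul_one] at this
  rw [Real.norm_of_nonneg (by positivity), pow_two]
  gcongr

theorem polyGaussian_add (P Q : MvPolynomial (Fin d) ℂ) (A : Matrix (Fin d) (Fin d) ℝ) :
    polyGaussian (P + Q) A = polyGaussian P A + polyGaussian Q A := by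
  ext x
  simp [polyGaussian, add_mul]

theorem polyGaussian_C_mul (c : ℂ) (Q : MvPolynomial (Fin d) ℂ) (A : Matrix (Fin d) (Fin d) ℝ)
    (x : EuclideanSpace ℝ (Fin d)) : polyGaussian (MvPolynomial.C c * Q) A x = c * polyGaussian Q A x := by
  simp [polyGaussian, mul_assoc]

theorem polyGaussian_mul_X (P : MvPolynomial (Fin d) ℂ) (i : Fin d)
    (A : Matrix (Fin d) (Fin d) ℝ) (x : EuclideanSpace ℝ (Fin d)) :
    polyGaussian (P * MvPolynomial.X i) A x = x i * polyGaussian P A x := by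
  simp [polyGaussian]
  ring

theorem hasDerivAt_eval_add_single (Q : MvPolynomial (Fin d) ℂ) (y : EuclideanSpace ℝ (Fin d)) (i : Fin d) :
    HasDerivAt (fun t : ℝ => MvPolynomial.eval
      (fun j => (((y + t • EuclideanSpace.single i (1 : ℝ)) j : ℝ) : ℂ)) Q)
      (MvPolynomial.eval (fun j => (y j : ℂ)) (MvPolynomial.pderiv i Q)) 0 := by
  induction Q using MvPolynomial.induction_on with
  | C a => simpa using hasDerivAt_const (0 : ℝ) a
  | add p q hp hq => simpa using! hp.add hq
  | mul_X p j hp =>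
    have hX : HasDerivAt (fun t : ℝ => (((y + t • EuclideanSpace.single i (1 : ℝ)) j : ℝ) : ℂ))
        (if j = i then 1 else 0) 0 := by
      simp only [PiLp.add_apply, PiLp.smul_apply, PiLp.single_apply, smul_eq_mul, mul_ite,
        mul_one, mul_zero, Complex.ofReal_add]
      refine HasDerivAt.const_add _ ?_
      split_ifs
      · exact (hasDerivAt_id (0 : ℝ)).ofReal_comp
      · simpa using hasDerivAt_const (0 : ℝ) (0 : ℂ)
    have := hp.mul hX
    simp only [map_mul, MvPolynomial.eval_X, Derivation.leibniz, smul_eq_mul, map_add,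
      MvPolynomial.pderiv_X]
    refine this.congr_deriv ?_
    rcases eq_or_ne j i with rfl | hji
    · simp; ring
    · simp [hji]; ring

/-- The polynomial factor of a partial derivative of `polyGaussian Q B`. -/
noncomputable def polyGaussianDeriv (Q : MvPolynomial (Fin d) ℂ) (B : Matrix (Fin d) (Fin d) ℝ)
    (i : Fin d) : MvPolynomial (Fin d) ℂ :=
  MvPolynomial.pderiv i Q -
    Q * ∑ j, MvPolynomial.C ((2 * Real.pi * B i j : ℝ) : ℂ) * MvPolynomial.X j

theorem hasDerivAt_polyGaussian_add_single (Q : MvPolynomial (Fin d) ℂ)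
    {B : Matrix (Fin d) (Fin d) ℝ} (hB : B.IsSymm) (y : EuclideanSpace ℝ (Fin d)) (i : Fin d) :
    HasDerivAt (fun t : ℝ => polyGaussian Q B (y + t • EuclideanSpace.single i (1 : ℝ)))
      (polyGaussian (polyGaussianDeriv Q B i) B y) 0 := by
  have hq : ∀ t : ℝ, (B *ᵥ (y + t • EuclideanSpace.single i (1 : ℝ)).ofLp) ⬝ᵥ
      (y + t • EuclideanSpace.single i (1 : ℝ)).ofLp =
      (B *ᵥ y.ofLp) ⬝ᵥ y.ofLp + t * (2 * (B *ᵥ y.ofLp) i) + t ^ 2 * B i i := by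
    intro t
    have h1 : (y + t • EuclideanSpace.single i (1 : ℝ)).ofLp = y.ofLp + t • Pi.single i 1 := by
      ext j; simp [Pi.single_apply]
    have h2 : y.ofLp ⬝ᵥ (B *ᵥ Pi.single i 1) = (B *ᵥ y.ofLp) i := by
      rw [Matrix.dotProduct_mulVec, ← Matrix.mulVec_transpose, hB.eq]
      simp
    rw [h1, Matrix.mulVec_add, Matrix.mulVec_smul, dotProduct_add, add_dotProduct, add_dotProduct,
      dotProduct_smul, dotProduct_smul, smul_dotProduct, smul_dotProduct, dotProduct_comm (B *ᵥ Pi.single i 1) y.ofLp,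
      h2]
    simp
    ring
  have hE : HasDerivAt (fun t : ℝ => -Real.pi * ((B *ᵥ (y + t • EuclideanSpace.single i (1 : ℝ)).ofLp)
      ⬝ᵥ (y + t • EuclideanSpace.single i (1 : ℝ)).ofLp)) (-Real.pi * (2 * (B *ᵥ y.ofLp) i)) 0 := by
    simp only [hq]
    refine HasDerivAt.const_mul _ ?_
    have := ((hasDerivAt_id (0 : ℝ)).mul_const (2 * (B *ᵥ y.ofLp) i)).const_add
      ((B *ᵥ y.ofLp) ⬝ᵥ y.ofLp) |>.add (((hasDerivAt_id (0 : ℝ)).pow 2).mul_const (B i i))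
    simpa using! this
  have := (hasDerivAt_eval_add_single Q y i).mul hE.exp.ofReal_comp
  unfold polyGaussian
  refine this.congr_deriv ?_
  have hs : MvPolynomial.eval (fun j => (y j : ℂ))
      (∑ j, MvPolynomial.C ((2 * Real.pi * B i j : ℝ) : ℂ) * MvPolynomial.X j) =
      ((2 * Real.pi * (B *ᵥ y.ofLp) i : ℝ) : ℂ) := by
    simp only [map_sum, map_mul, MvPolynomial.eval_C, MvPolynomial.eval_X, Matrix.mulVec, dotProduct]
    push_cast
    rw [Finset.mul_sum]
    exact Finset.sum_congr rfl fun j _ => by ring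
  rw [polyGaussianDeriv, map_sub, map_mul, hs, zero_smul, add_zero]
  push_cast
  ring

/-- With A = LᵀL, the change of variables u = Lx reduces to the standard Gaussian, which is its own
transform; the frequency becomes the transpose of L⁻¹ applied to y. -/
theorem fourier_polyGaussian_one (hA : A.PosDef) :
    ∃ κ : ℂ, ∀ y, 𝓕 (polyGaussian 1 A) y = κ * polyGaussian 1 A⁻¹ y := by
  obtain ⟨L, hL, rfl⟩ := hA.exists_eq_transpose_mul_self
  have hinv : (Lᵀ * L)⁻¹ = (L⁻¹ᵀ)ᵀ * L⁻¹ᵀ := by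
    rw [Matrix.mul_inv_rev, Matrix.transpose_transpose, Matrix.transpose_nonsing_inv]
  set T := Matrix.toLpLin 2 2 L with hT
  have hLinv : L⁻¹ * L = 1 := Matrix.nonsing_inv_mul L hL
  have hTinj : Function.Injective T := fun x y hxy => by
    have h1 := congrArg (fun u : EuclideanSpace ℝ (Fin d) => L⁻¹ *ᵥ u.ofLp) hxy
    simp only [hT, Matrix.toLpLin_apply, Matrix.mulVec_mulVec, hLinv, Matrix.one_mulVec] at h1
    exact WithLp.ofLp_injective 2 h1
  set e := (LinearEquiv.ofInjectiveEndo T hTinj) with he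
  have heT : ∀ x, e x = T x := fun x => rfl
  have hdet : LinearMap.det T ≠ 0 := (LinearEquiv.isUnit_det' e).ne_zero
  set γ : EuclideanSpace ℝ (Fin d) → ℂ := fun v => Complex.exp (-Real.pi * ‖v‖ ^ 2) with hγ
  have hγF : ∀ w, 𝓕 γ w = γ w := fun w => by
    have := fourier_gaussian_innerProductSpace (V := EuclideanSpace ℝ (Fin d)) (b := Real.pi)
      (by simpa using Real.pi_pos) w
    have hpi : (Real.pi : ℂ) ≠ 0 := by exact_mod_cast Real.pi_ne_zero
    rw [hγ, this, div_self hpi, Complex.one_cpow, one_mul]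
    congr 1
    field_simp
  have hpg : ∀ (N : Matrix (Fin d) (Fin d) ℝ) (x : EuclideanSpace ℝ (Fin d)),
      polyGaussian 1 (Nᵀ * N) x = γ (WithLp.toLp 2 (N *ᵥ x.ofLp)) := fun N x => by
    rw [polyGaussian, Matrix.dotProduct_transpose_mul_self_mulVec, hγ]
    simp
  refine ⟨((|(LinearMap.det T)⁻¹| : ℝ) : ℂ), fun y => ?_⟩
  rw [hinv, hpg, ← hγF, Real.fourier_eq, Real.fourier_eq]
  set w : EuclideanSpace ℝ (Fin d) := WithLp.toLp 2 (L⁻¹ᵀ *ᵥ y.ofLp) with hw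
  have hTe : MeasurableEmbedding T := by
    exact e.toContinuousLinearEquiv.toHomeomorph.measurableEmbedding
  have h2 := hTe.integral_map (μ := volume)
    (g := fun u => Real.fourierChar (-inner ℝ u w) • γ u)
  rw [Measure.map_linearMap_addHaar_eq_smul_addHaar volume hdet, integral_smul_measure,
    ENNReal.toReal_ofReal (abs_nonneg _), Complex.real_smul] at h2
  rw [h2]
  refine integral_congr_ae (Filter.Eventually.of_forall fun x => ?_)
  have hin : inner ℝ (T x) w = inner ℝ x y := by
    rw [EuclideanSpace.inner_eq_star_dotProduct, EuclideanSpace.inner_eq_star_dotProduct,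
      star_trivial, star_trivial]
    change (L⁻¹ᵀ *ᵥ y.ofLp) ⬝ᵥ (L *ᵥ x.ofLp) = _
    rw [Matrix.mulVec_transpose, ← Matrix.dotProduct_mulVec, Matrix.mulVec_mulVec, hLinv,
      Matrix.one_mulVec]
  simp only [hin, hpg]
  rfl

/-- Differentiation under the Fourier integral; this is the inductive step that builds up the
polynomial factor. -/
theorem fourier_mul_coord {f : EuclideanSpace ℝ (Fin d) → ℂ} (hf : Integrable f)
    (hf' : Integrable fun x => ‖x‖ * ‖f x‖) (i : Fin d) (y : EuclideanSpace ℝ (Fin d)) {D : ℂ}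
    (hD : HasDerivAt (fun t : ℝ => 𝓕 f (y + t • EuclideanSpace.single i (1 : ℝ))) D 0) :
    𝓕 (fun x => (x i : ℂ) * f x) y = Complex.I / (2 * Real.pi) * D := by
  set v : EuclideanSpace ℝ (Fin d) := EuclideanSpace.single i (1 : ℝ)
  set F := VectorFourier.fourierSMulRight (innerSL ℝ) f with hF
  have hFint : Integrable F := by
    refine Integrable.mono' (hf'.const_mul (2 * Real.pi * ‖innerSL ℝ (E := EuclideanSpace ℝ (Fin d))‖))
      hf.1.fourierSMulRight (Filter.Eventually.of_forall fun x => ?_)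
    have := VectorFourier.norm_fourierSMulRight_le (innerSL ℝ (E := EuclideanSpace ℝ (Fin d))) f x
    linarith
  have hline : HasDerivAt (fun t : ℝ => y + t • v) v 0 := by
    simpa using! ((hasDerivAt_id (0 : ℝ)).smul_const v).const_add y
  have hfd : HasFDerivAt (𝓕 f) (𝓕 F y) (y + (0 : ℝ) • v) := by
    rw [zero_smul, add_zero]
    exact Real.hasFDerivAt_fourier hf hf' y
  have hDF : D = 𝓕 (fun x => F x v) y := by
    rw [← Real.fourier_continuousLinearMap_apply hFint]
    exact hD.unique (hfd.comp_hasDerivAt (0 : ℝ) hline)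
  have hFx : (fun x => F x v) = (-(2 * Real.pi * Complex.I)) • fun x => (x i : ℂ) * f x := by
    ext x
    have h1 : (innerSL ℝ) x (EuclideanSpace.single i (1 : ℝ)) = x i := by
      rw [innerSL_apply_apply, EuclideanSpace.inner_single_right]
      simp
    simp [hF, v, h1]
  have hsmul : 𝓕 ((-(2 * Real.pi * Complex.I)) • fun x : EuclideanSpace ℝ (Fin d) => (x i : ℂ) * f x) =
      (-(2 * Real.pi * Complex.I)) • 𝓕 (fun x : EuclideanSpace ℝ (Fin d) => (x i : ℂ) * f x) :=
    VectorFourier.fourierIntegral_const_smul _ _ _ _ _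
  have hpi : (Real.pi : ℂ) ≠ 0 := by exact_mod_cast Real.pi_ne_zero
  rw [hDF, hFx, hsmul, Pi.smul_apply, smul_eq_mul]
  field_simp
  rw [Complex.I_sq]
  ring

/-- The Fourier transform maps a polynomial times a Gaussian to a function of the same kind. -/
theorem exists_fourier_polyGaussian (hA : A.PosDef) (P : MvPolynomial (Fin d) ℂ) :
    ∃ Q : MvPolynomial (Fin d) ℂ, 𝓕 (polyGaussian P A) = polyGaussian Q A⁻¹ := by
  have hsymm : A⁻¹.IsSymm := by
    have := hA.inv.isHermitian
    rwa [Matrix.IsHermitian, Matrix.conjTranspose_eq_transpose_of_trivial] at this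
  induction P using MvPolynomial.induction_on with
  | C a =>
    obtain ⟨κ, hκ⟩ := fourier_polyGaussian_one hA
    refine ⟨MvPolynomial.C (a * κ), funext fun y => ?_⟩
    have h1 : polyGaussian (MvPolynomial.C a) A = a • polyGaussian 1 A := by
      ext x
      simp [polyGaussian]
    have h2 : 𝓕 (a • polyGaussian 1 A) = a • 𝓕 (polyGaussian 1 A) :=
      VectorFourier.fourierIntegral_const_smul _ _ _ _ _
    rw [h1, h2, Pi.smul_apply, hκ, ← mul_one (MvPolynomial.C _), polyGaussian_C_mul, smul_eq_mul,
      mul_assoc]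
  | add p q hp hq =>
    obtain ⟨P, hP⟩ := hp
    obtain ⟨Q, hQ⟩ := hq
    refine ⟨P + Q, funext fun y => ?_⟩
    rw [polyGaussian_add, polyGaussian_add, ← hP, ← hQ, Pi.add_apply, Real.fourier_eq,
      Real.fourier_eq, Real.fourier_eq, ← integral_add]
    · simp
    · exact (Real.fourierIntegral_convergent_iff y).2 (integrable_polyGaussian p hA)
    · exact (Real.fourierIntegral_convergent_iff y).2 (integrable_polyGaussian q hA)
  | mul_X p i hp =>
    obtain ⟨Q, hQ⟩ := hp
    refine ⟨MvPolynomial.C (Complex.I / (2 * Real.pi)) * polyGaussianDeriv Q A⁻¹ i,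
      funext fun y => ?_⟩
    rw [polyGaussian_C_mul, ← fourier_mul_coord (integrable_polyGaussian p hA) ?_ i y
      (by rw [hQ]; exact hasDerivAt_polyGaussian_add_single Q hsymm y i)]
    · exact congrFun (congrArg _ (funext fun x => polyGaussian_mul_X p i A x)) y
    · obtain ⟨C, h, hC⟩ := exists_norm_polyGaussian_le p hA (d + 2)
      refine Integrable.mono' ((integrable_one_add_norm (μ := volume)
        (E := EuclideanSpace ℝ (Fin d)) (r := ((d + 1 : ℕ) : ℝ)) (by simp)).const_mul C)
        (continuous_norm.mul (continuous_polyGaussian p A).norm).aestronglyMeasurable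
        (Filter.Eventually.of_forall fun x => ?_)
      rw [Real.norm_of_nonneg (by positivity)]
      refine (mul_le_mul_of_nonneg_left (hC x) (norm_nonneg x)).trans ?_
      have hx := norm_nonneg x
      have e1 : (1 + ‖x‖) ^ (-((d + 1 : ℕ) : ℝ)) =
          (1 + ‖x‖) * (1 + ‖x‖) ^ (-((d + 2 : ℕ) : ℝ)) := by
        rw [← Real.rpow_one_add' (by positivity)]
        · congr 1; push_cast; ring
        · push_cast; linarith [(Nat.cast_nonneg d : (0 : ℝ) ≤ d)]
      rw [e1]
      have e2 : 0 ≤ (1 + ‖x‖) ^ (-((d + 2 : ℕ) : ℝ)) := by positivity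
      have e3 := mul_nonneg h e2
      nlinarith

theorem fourier_ae_eq_polyGaussian (hA : A.PosDef) (P : MvPolynomial (Fin d) ℂ) :
    ∃ Q : MvPolynomial (Fin d) ℂ, ∀ f : Lp ℂ 2 (volume : Measure (EuclideanSpace ℝ (Fin d))),
      f =ᵐ[volume] polyGaussian P A →
        (𝓕 f : Lp ℂ 2 (volume : Measure (EuclideanSpace ℝ (Fin d)))) =ᵐ[volume] polyGaussian Q A⁻¹ := by
  obtain ⟨Q, hQ⟩ := exists_fourier_polyGaussian hA P
  refine ⟨Q, fun f hf => ?_⟩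
  have h2 := memLp_polyGaussian P hA
  have : f = h2.toLp _ := Lp.ext (hf.trans h2.coeFn_toLp.symm)
  rw [this, ← hQ]
  exact fourier_toLp_ae_eq (integrable_polyGaussian P hA) h2

theorem ae_eq_polyGaussian_of_fourier (hA : A.PosDef) (P : MvPolynomial (Fin d) ℂ)
    (f : Lp ℂ 2 (volume : Measure (EuclideanSpace ℝ (Fin d))))
    (hf : (𝓕 f : Lp ℂ 2 (volume : Measure (EuclideanSpace ℝ (Fin d)))) =ᵐ[volume] polyGaussian P A) :
    ∃ Q : MvPolynomial (Fin d) ℂ, f =ᵐ[volume] polyGaussian Q A⁻¹ := by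
  obtain ⟨Q, hQ⟩ := exists_fourier_polyGaussian hA P
  -- R(x) = Q(-x), because the inverse transform is the reflected transform. Injectivity on L² then
  -- identifies f.
  set R : MvPolynomial (Fin d) ℂ :=
    MvPolynomial.aeval (fun i => -(MvPolynomial.X i : MvPolynomial (Fin d) ℂ)) Q with hR
  have hRQ : polyGaussian R A⁻¹ = 𝓕⁻ (polyGaussian P A) := by
    ext x
    have h1 : MvPolynomial.eval (fun i => (x i : ℂ)) R =
        MvPolynomial.eval (fun i => (((-x) i : ℝ) : ℂ)) Q := by
      rw [hR, MvPolynomial.aeval_def, MvPolynomial.eval_eval₂]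
      simp only [MvPolynomial.algebraMap_eq, RingHom.comp, map_neg, MvPolynomial.eval_X]
      rw [← MvPolynomial.eval₂_id]
      congr 1
      · ext; simp
      · simp
    rw [Real.fourierInv_eq_fourier_neg, hQ, polyGaussian, polyGaussian, h1, WithLp.ofLp_neg,
      Matrix.mulVec_neg, neg_dotProduct_neg]
  have hFR : 𝓕 (polyGaussian R A⁻¹) = polyGaussian P A := by
    rw [hRQ]
    refine (continuous_polyGaussian P A).fourier_fourierInv_eq (integrable_polyGaussian P hA) ?_
    rw [hQ]
    exact integrable_polyGaussian Q hA.inv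
  have h2 := memLp_polyGaussian R hA.inv
  have h3 := fourier_toLp_ae_eq (integrable_polyGaussian R hA.inv) h2
  rw [hFR] at h3
  have h4 : (𝓕 f : Lp ℂ 2 (volume : Measure (EuclideanSpace ℝ (Fin d)))) = 𝓕 (h2.toLp _) :=
    Lp.ext (hf.trans h3.symm)
  have h5 : f = h2.toLp _ := (Lp.fourierTransformₗᵢ (EuclideanSpace ℝ (Fin d)) ℂ).injective h4
  refine ⟨R, ?_⟩
  rw [h5]
  exact h2.coeFn_toLp

/-- A matrix is positive definite if a nonzero polynomial times the corresponding Gaussian tends to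
zero along all lines. -/
theorem posDef_of_tendsto_polyGaussian {D : Matrix (Fin d) (Fin d) ℝ} (hD : D.IsSymm)
    {Q : MvPolynomial (Fin d) ℂ} {u : EuclideanSpace ℝ (Fin d)} (hu : polyGaussian Q D u ≠ 0)
    (h : ∀ v : EuclideanSpace ℝ (Fin d), v ≠ 0 →
      Filter.Tendsto (fun r : ℝ => polyGaussian Q D (u + r • v)) Filter.atTop (nhds 0)) :
    D.PosDef := by
  have hcross : ∀ v : EuclideanSpace ℝ (Fin d), ∀ r : ℝ,
      (D *ᵥ (u + r • v).ofLp) ⬝ᵥ (u + r • v).ofLp =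
      (D *ᵥ u.ofLp) ⬝ᵥ u.ofLp + 2 * r * ((D *ᵥ u.ofLp) ⬝ᵥ v.ofLp) +
        r ^ 2 * ((D *ᵥ v.ofLp) ⬝ᵥ v.ofLp) := by
    intro v r
    have h2 : (D *ᵥ v.ofLp) ⬝ᵥ u.ofLp = (D *ᵥ u.ofLp) ⬝ᵥ v.ofLp := by
      rw [dotProduct_comm, Matrix.dotProduct_mulVec, ← Matrix.mulVec_transpose, hD.eq]
    rw [WithLp.ofLp_add, WithLp.ofLp_smul, Matrix.mulVec_add, Matrix.mulVec_smul, dotProduct_add,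
      add_dotProduct, add_dotProduct, dotProduct_smul, dotProduct_smul, smul_dotProduct,
      smul_dotProduct, h2]
    simp only [smul_eq_mul]
    ring
  -- If ⟨Dv,v⟩ ≤ 0 and ⟨Du,v⟩ ≤ 0, the Gaussian along u + rv never falls below its value at u. So
  -- the polynomial factor itself tends to zero and vanishes identically, against its value at r =
  -- 0. Replacing v by -v arranges the sign of ⟨Du,v⟩.
  have key : ∀ v : EuclideanSpace ℝ (Fin d), v ≠ 0 → (D *ᵥ u.ofLp) ⬝ᵥ v.ofLp ≤ 0 →
      0 < (D *ᵥ v.ofLp) ⬝ᵥ v.ofLp := by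
    intro v hv huv
    by_contra! hvv
    set p : Polynomial ℂ := MvPolynomial.aeval
      (fun i => Polynomial.C (u i : ℂ) + Polynomial.C (v i : ℂ) * Polynomial.X) Q with hp
    have hpe : ∀ r : ℝ, p.eval (r : ℂ) =
        MvPolynomial.eval (fun i => (((u + r • v) i : ℝ) : ℂ)) Q := by
      intro r
      rw [hp, MvPolynomial.aeval_def, ← Polynomial.coe_evalRingHom, MvPolynomial.hom_eval₂,
        ← MvPolynomial.eval₂_id]
      congr 1
      · ext; simp
      · ext i; simp; ring
    have hlim : Filter.Tendsto (fun r : ℝ => ‖p.eval (r : ℂ)‖) Filter.atTop (nhds 0) := by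
      have h1 := ((h v hv).norm.mul_const (Real.exp (Real.pi * ((D *ᵥ u.ofLp) ⬝ᵥ u.ofLp))))
      rw [norm_zero, zero_mul] at h1
      refine squeeze_zero' (Filter.Eventually.of_forall fun r => norm_nonneg _) ?_ h1
      filter_upwards [Filter.eventually_ge_atTop 0] with r hr
      rw [norm_polyGaussian, ← hpe, mul_assoc, ← Real.exp_add]
      refine le_mul_of_one_le_right (norm_nonneg _) (Real.one_le_exp ?_)
      rw [hcross]
      have e1 : r * ((D *ᵥ u.ofLp) ⬝ᵥ v.ofLp) ≤ 0 := mul_nonpos_of_nonneg_of_nonpos hr huv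
      have e2 : r ^ 2 * ((D *ᵥ v.ofLp) ⬝ᵥ v.ofLp) ≤ 0 :=
        mul_nonpos_of_nonneg_of_nonpos (sq_nonneg r) hvv
      nlinarith [Real.pi_pos]
    have hp0 : p.eval (0 : ℂ) ≠ 0 := by
      have h1 := hpe 0
      rw [zero_smul, add_zero, Complex.ofReal_zero] at h1
      rw [h1]
      exact left_ne_zero_of_mul hu
    by_cases hdeg : 0 < p.degree
    · have hz : Filter.Tendsto (fun t : ℝ => ‖(t : ℂ)‖) Filter.atTop Filter.atTop := by
        simpa using Filter.tendsto_abs_atTop_atTop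
      exact not_tendsto_nhds_of_tendsto_atTop (p.tendsto_norm_atTop hdeg hz) 0 hlim
    · rw [Polynomial.eq_C_of_degree_le_zero (not_lt.1 hdeg)] at hlim hp0
      simp only [Polynomial.eval_C] at hlim hp0
      exact hp0 (norm_eq_zero.1 (tendsto_nhds_unique tendsto_const_nhds hlim))
  rw [Matrix.posDef_iff_dotProduct_mulVec]
  refine ⟨by rwa [Matrix.IsHermitian, Matrix.conjTranspose_eq_transpose_of_trivial], fun x hx => ?_⟩
  rw [star_trivial, dotProduct_comm]
  have hx' : (WithLp.toLp 2 x : EuclideanSpace ℝ (Fin d)) ≠ 0 := by simpa using hx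
  rcases le_total ((D *ᵥ u.ofLp) ⬝ᵥ x) 0 with h1 | h1
  · exact key (WithLp.toLp 2 x) hx' h1
  · have := key (-WithLp.toLp 2 x) (neg_ne_zero.2 hx') (by simpa using h1)
    simpa [Matrix.mulVec_neg] using this

theorem isSlowlyIncreasing_of_ae_eq_polyGaussian (hA : A.PosDef) {P : MvPolynomial (Fin d) ℂ}
    {f : Lp ℂ 2 (volume : Measure (EuclideanSpace ℝ (Fin d)))}
    (hf : f =ᵐ[volume] polyGaussian P A) :
    IsSlowlyIncreasing
        (fun z : EuclideanSpace ℝ (Fin d) × EuclideanSpace ℝ (Fin d) =>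
          f z.1 * 𝓕 f z.2 * (Real.exp (2 * Real.pi * |inner ℝ z.1 z.2|) : ℂ)) := by
  obtain ⟨Q, hQ⟩ := fourier_ae_eq_polyGaussian hA P
  have hQ := hQ f hf
  obtain ⟨C₁, M₁, h₁, hP⟩ := P.exists_norm_eval_le
  obtain ⟨C₂, M₂, h₂, hQP⟩ := Q.exists_norm_eval_le
  refine ⟨C₁ * C₂, M₁ + M₂, ?_⟩
  have e1 := (Measure.quasiMeasurePreserving_fst (μ := (volume : Measure (EuclideanSpace ℝ (Fin d))))
    (ν := (volume : Measure (EuclideanSpace ℝ (Fin d))))).ae_eq hf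
  have e2 := (Measure.quasiMeasurePreserving_snd (μ := (volume : Measure (EuclideanSpace ℝ (Fin d))))
    (ν := (volume : Measure (EuclideanSpace ℝ (Fin d))))).ae_eq hQ
  rw [← Measure.volume_eq_prod] at e1 e2
  filter_upwards [e1, e2] with z h1 h2
  simp only [Function.comp] at h1 h2
  rw [h1, h2, norm_mul, norm_mul, norm_polyGaussian, norm_polyGaussian,
    Complex.norm_of_nonneg (Real.exp_pos _).le, mul_mul_mul_comm, ← Real.exp_add, mul_assoc,
    ← Real.exp_add]
  have hx := norm_nonneg z.1
  have hy := norm_nonneg z.2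
  have h3 : Real.exp (-Real.pi * ((A *ᵥ z.1.ofLp) ⬝ᵥ z.1.ofLp) +
      -Real.pi * ((A⁻¹ *ᵥ z.2.ofLp) ⬝ᵥ z.2.ofLp) + 2 * Real.pi * |inner ℝ z.1 z.2|) ≤ 1 := by
    rw [Real.exp_le_one_iff]
    have := mul_le_mul_of_nonneg_left (hA.two_mul_abs_inner_le z.1 z.2) Real.pi_pos.le
    linarith
  refine (mul_le_of_le_one_right (by positivity) h3).trans ?_
  rw [pow_add, mul_mul_mul_comm]
  refine mul_le_mul ((hP z.1).trans ?_) ((hQP z.2).trans ?_) (norm_nonneg _) (by positivity)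
  · exact mul_le_mul_of_nonneg_left (pow_le_pow_left₀ (by linarith) (by linarith) _) h₁
  · exact mul_le_mul_of_nonneg_left (pow_le_pow_left₀ (by linarith) (by linarith) _) h₂

end PolyGaussian

/-! ### The damped transform and its entire extension -/

section EntireFourier

variable {d : ℕ}

/-- The bilinear pairing of a complex vector with a real one. -/
noncomputable def complexPairing (ζ : Fin d → ℂ) (y : EuclideanSpace ℝ (Fin d)) : ℂ :=
  ∑ i, ζ i * (y i : ℂ)

/-- The entire extension of the inverse Fourier transform. -/
noncomputable def entireFourierInv (h : EuclideanSpace ℝ (Fin d) → ℂ) (ζ : Fin d → ℂ) : ℂ :=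
  ∫ y, h y * Complex.exp (2 * Real.pi * Complex.I * complexPairing ζ y)

/-- The product of a function with the standard Gaussian. -/
noncomputable def gaussianDamped (F : EuclideanSpace ℝ (Fin d) → ℂ)
    (y : EuclideanSpace ℝ (Fin d)) : ℂ :=
  F y * (Real.exp (-Real.pi * ‖y‖ ^ 2) : ℂ)

theorem continuous_complexPairing (ζ : Fin d → ℂ) : Continuous (complexPairing ζ) := by
  unfold complexPairing
  fun_prop

theorem norm_complexPairing_le (ζ : Fin d → ℂ) (y : EuclideanSpace ℝ (Fin d)) :
    ‖complexPairing ζ y‖ ≤ (∑ i, ‖ζ i‖) * ‖y‖ := by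
  rw [complexPairing, Finset.sum_mul]
  refine (norm_sum_le _ _).trans (Finset.sum_le_sum fun i _ => ?_)
  rw [norm_mul, Complex.norm_real]
  exact mul_le_mul_of_nonneg_left (PiLp.norm_apply_le y i) (norm_nonneg _)

theorem complexPairing_smul (z : ℂ) (ζ : Fin d → ℂ) (y : EuclideanSpace ℝ (Fin d)) :
    complexPairing (z • ζ) y = z * complexPairing ζ y := by
  simp [complexPairing, Finset.mul_sum, mul_assoc]

theorem complexPairing_ofReal (x y : EuclideanSpace ℝ (Fin d)) :
    complexPairing (fun i => (x i : ℂ)) y = (inner ℝ x y : ℝ) := by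
  simp [complexPairing, PiLp.inner_apply, mul_comm]

theorem norm_gaussianDamped (F : EuclideanSpace ℝ (Fin d) → ℂ) (y : EuclideanSpace ℝ (Fin d)) :
    ‖gaussianDamped F y‖ = ‖F y‖ * Real.exp (-Real.pi * ‖y‖ ^ 2) := by
  rw [gaussianDamped, norm_mul, Complex.norm_of_nonneg (Real.exp_pos _).le]

theorem polyGaussian_one_smul_one (c : ℝ) (x : EuclideanSpace ℝ (Fin d)) :
    polyGaussian 1 (c • (1 : Matrix (Fin d) (Fin d) ℝ)) x =
      (Real.exp (-Real.pi * (c * ‖x‖ ^ 2)) : ℂ) := by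
  rw [polyGaussian, map_one, one_mul, Matrix.smul_mulVec, Matrix.one_mulVec, smul_dotProduct,
    ← real_inner_self_eq_norm_sq, EuclideanSpace.inner_eq_star_dotProduct, star_trivial, smul_eq_mul]

theorem posDef_smul_one {c : ℝ} (hc : 0 < c) : (c • (1 : Matrix (Fin d) (Fin d) ℝ)).PosDef :=
  Matrix.PosDef.one.smul hc

/-- The weight `‖F y‖ exp (-π ‖y‖ ^ 2 / 2)`. -/
noncomputable def gaussianWeight (F : EuclideanSpace ℝ (Fin d) → ℂ)
    (y : EuclideanSpace ℝ (Fin d)) : ℝ :=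
  ‖F y‖ * Real.exp (-(Real.pi / 2) * ‖y‖ ^ 2)

variable {F : EuclideanSpace ℝ (Fin d) → ℂ}

theorem integrable_gaussianWeight (hF : MemLp F 2) : Integrable (gaussianWeight F) := by
  have h1 := (memLp_polyGaussian 1 (posDef_smul_one (d := d) (c := 1 / 2) (by norm_num))).norm
  refine (hF.norm.integrable_mul h1).congr (Filter.Eventually.of_forall fun y => ?_)
  simp only [Pi.mul_apply, gaussianWeight]
  rw [polyGaussian_one_smul_one, Complex.norm_of_nonneg (Real.exp_pos _).le]
  ring_nf

theorem gaussianWeight_nonneg (y : EuclideanSpace ℝ (Fin d)) : 0 ≤ gaussianWeight F y := by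
  unfold gaussianWeight; positivity

/-- Half of the Gaussian absorbs the exponential: (π/2)(‖y‖ - 2s)² ≥ 0. The other half stays in the
weight and keeps it integrable. This gives order at most two. -/
theorem norm_gaussianDamped_mul_exp_le (y : EuclideanSpace ℝ (Fin d)) (s : ℝ) :
    ‖gaussianDamped F y‖ * Real.exp (2 * Real.pi * s * ‖y‖) ≤
      gaussianWeight F y * Real.exp (2 * Real.pi * s ^ 2) := by
  rw [norm_gaussianDamped, gaussianWeight, mul_assoc ‖F y‖, mul_assoc ‖F y‖, ← Real.exp_add,
    ← Real.exp_add]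
  refine mul_le_mul_of_nonneg_left (Real.exp_le_exp.2 ?_) (norm_nonneg _)
  nlinarith [mul_nonneg Real.pi_pos.le (sq_nonneg (‖y‖ - 2 * s))]

theorem aestronglyMeasurable_gaussianDamped (hF : MemLp F 2) :
    AEStronglyMeasurable (gaussianDamped F) := by
  refine hF.1.mul (Continuous.aestronglyMeasurable ?_)
  fun_prop

theorem integrable_gaussianDamped_mul_exp (hF : MemLp F 2) (s : ℝ) :
    Integrable fun y => ‖gaussianDamped F y‖ * Real.exp (2 * Real.pi * s * ‖y‖) := by
  refine ((integrable_gaussianWeight hF).mul_const (Real.exp (2 * Real.pi * s ^ 2))).mono'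
    ((aestronglyMeasurable_gaussianDamped hF).norm.mul
      (Continuous.aestronglyMeasurable (by fun_prop)))
    (Filter.Eventually.of_forall fun y => ?_)
  rw [Real.norm_of_nonneg (by positivity)]
  exact norm_gaussianDamped_mul_exp_le y s

theorem integrable_gaussianDamped (hF : MemLp F 2) : Integrable (gaussianDamped F) := by
  rw [← integrable_norm_iff (aestronglyMeasurable_gaussianDamped hF)]
  simpa using integrable_gaussianDamped_mul_exp hF 0

theorem memLp_gaussianDamped (hF : MemLp F 2) : MemLp (gaussianDamped F) 2 := by
  refine hF.of_le (aestronglyMeasurable_gaussianDamped hF) (Filter.Eventually.of_forall fun y => ?_)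
  rw [norm_gaussianDamped]
  refine mul_le_of_le_one_right (norm_nonneg _) (Real.exp_le_one_iff.2 ?_)
  have := mul_nonneg Real.pi_pos.le (sq_nonneg ‖y‖)
  linarith

theorem norm_entireFourierInv_le (hF : MemLp F 2) (ζ : Fin d → ℂ) :
    ‖entireFourierInv (gaussianDamped F) ζ‖ ≤
      (∫ y, gaussianWeight F y) * Real.exp (2 * Real.pi * (∑ i, ‖ζ i‖) ^ 2) := by
  rw [entireFourierInv, ← integral_mul_const]
  refine norm_integral_le_of_norm_le ((integrable_gaussianWeight hF).mul_const _)
    (Filter.Eventually.of_forall fun y => ?_)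
  refine le_trans ?_ (norm_gaussianDamped_mul_exp_le y (∑ i, ‖ζ i‖))
  rw [norm_mul]
  refine mul_le_mul_of_nonneg_left ?_ (norm_nonneg _)
  refine (Complex.norm_exp_le_exp_norm _).trans (Real.exp_le_exp.2 ?_)
  rw [norm_mul]
  have h1 : ‖(2 * Real.pi * Complex.I : ℂ)‖ = 2 * Real.pi := by
    simp [abs_of_pos Real.pi_pos]
  rw [h1, mul_assoc (2 * Real.pi)]
  exact mul_le_mul_of_nonneg_left (norm_complexPairing_le ζ y) Real.two_pi_pos.le

/-- Peeling off one factor of the pairing replaces h by its products with the coordinates, hence the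
quantifier over h and the assumption on all moments. -/
theorem exists_polynomial_eq_integral_pairing_pow (k : ℕ) :
    ∀ h : EuclideanSpace ℝ (Fin d) → ℂ, (∀ N : ℕ, Integrable fun y => (‖y‖ ^ N : ℂ) * h y) →
      ∃ p : MvPolynomial (Fin d) ℂ, ∀ x, MvPolynomial.eval x p = ∫ y, h y * complexPairing x y ^ k := by
  induction k with
  | zero => exact fun h _ => ⟨MvPolynomial.C (∫ y, h y), fun x => by simp⟩
  | succ k ih =>
    intro h hh
    have hmeas : AEStronglyMeasurable h := by simpa using (hh 0).1
    have hcoord : ∀ (i : Fin d) (N : ℕ), Integrable fun y => (‖y‖ ^ N : ℂ) * ((y i : ℂ) * h y) := by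
      intro i N
      refine (hh (N + 1)).mono ((Continuous.aestronglyMeasurable (by fun_prop)).mul
        ((Continuous.aestronglyMeasurable (by fun_prop)).mul hmeas))
        (Filter.Eventually.of_forall fun y => ?_)
      rw [norm_mul, norm_mul, norm_mul, pow_succ, norm_mul, mul_assoc, Complex.norm_real]
      have := PiLp.norm_apply_le y i
      gcongr
      simpa using this
    choose p hp using fun i => ih (fun y => (y i : ℂ) * h y) (hcoord i)
    refine ⟨∑ i, MvPolynomial.X i * p i, fun x => ?_⟩
    have hint : ∀ i, Integrable fun y => x i * ((y i : ℂ) * h y * complexPairing x y ^ k) := by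
      intro i
      refine Integrable.const_mul ?_ _
      refine ((hcoord i k).norm.const_mul ((∑ i, ‖x i‖) ^ k)).mono'
        (((Continuous.aestronglyMeasurable (by fun_prop)).mul hmeas).mul
        (((continuous_complexPairing x).pow k).aestronglyMeasurable))
        (Filter.Eventually.of_forall fun y => ?_)
      rw [norm_mul, norm_pow, norm_mul (_ ^ k), norm_pow, Complex.norm_real, norm_norm, mul_comm,
        ← mul_assoc, ← mul_pow]
      gcongr
      exact norm_complexPairing_le x y
    simp only [map_sum, map_mul, MvPolynomial.eval_X, hp]
    simp_rw [← integral_const_mul]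
    rw [← integral_finsetSum _ fun i _ => hint i]
    refine integral_congr_ae (Filter.Eventually.of_forall fun y => ?_)
    have hs : complexPairing x y ^ (k + 1) = ∑ i, x i * (y i : ℂ) * complexPairing x y ^ k := by
      rw [pow_succ', ← Finset.sum_mul, complexPairing]
    simp only
    rw [hs, Finset.mul_sum]
    exact Finset.sum_congr rfl fun i _ => by ring

theorem integrable_norm_pow_mul_gaussianDamped (hF : MemLp F 2) (N : ℕ) :
    Integrable fun y => (‖y‖ ^ N : ℂ) * gaussianDamped F y := by
  refine ((integrable_gaussianDamped_mul_exp hF 1).const_mul (N.factorial : ℝ)).mono'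
    ((Continuous.aestronglyMeasurable (by fun_prop)).mul (aestronglyMeasurable_gaussianDamped hF))
    (Filter.Eventually.of_forall fun y => ?_)
  have h1 := Real.pow_div_factorial_le_exp (x := ‖y‖) (hx := norm_nonneg y) N
  rw [div_le_iff₀ (by positivity)] at h1
  have h2 : Real.exp ‖y‖ ≤ Real.exp (2 * Real.pi * 1 * ‖y‖) :=
    Real.exp_le_exp.2 (by nlinarith [norm_nonneg y, Real.pi_gt_three])
  rw [norm_mul, norm_pow, Complex.norm_real, norm_norm]
  calc ‖y‖ ^ N * ‖gaussianDamped F y‖ ≤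
      (Real.exp (2 * Real.pi * 1 * ‖y‖) * N.factorial) * ‖gaussianDamped F y‖ := by
        gcongr
        exact h1.trans (by gcongr)
    _ = _ := by ring

theorem hasSum_entireFourierInv (hF : MemLp F 2) (x : Fin d → ℂ) (z : ℂ) :
    HasSum (fun k : ℕ => ((2 * Real.pi * Complex.I) ^ k / (k.factorial : ℂ) *
      ∫ y, gaussianDamped F y * complexPairing x y ^ k) * z ^ k)
      (entireFourierInv (gaussianDamped F) (z • x)) := by
  have hm := aestronglyMeasurable_gaussianDamped hF
  have h1 : ‖(2 * Real.pi * Complex.I : ℂ)‖ = 2 * Real.pi := by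
    simp [abs_of_pos Real.pi_pos]
  set s := ‖z‖ * ∑ i, ‖x i‖ with hs
  have hexp : ∀ y : EuclideanSpace ℝ (Fin d), HasSum
      (fun k : ℕ => ‖gaussianDamped F y‖ * ((2 * Real.pi * s * ‖y‖) ^ k / k.factorial))
      (‖gaussianDamped F y‖ * Real.exp (2 * Real.pi * s * ‖y‖)) := fun y => by
    have h := NormedSpace.expSeries_div_hasSum_exp (𝔸 := ℝ) (2 * Real.pi * s * ‖y‖)
    rw [← Real.exp_eq_exp_ℝ] at h
    exact h.mul_left _
  have key := hasSum_integral_of_dominated_convergence (μ := volume)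
    (F := fun (k : ℕ) y => gaussianDamped F y *
      ((2 * Real.pi * Complex.I * complexPairing (z • x) y) ^ k / (k.factorial : ℂ)))
    (f := fun y => gaussianDamped F y *
      Complex.exp (2 * Real.pi * Complex.I * complexPairing (z • x) y))
    (fun (k : ℕ) y => ‖gaussianDamped F y‖ * ((2 * Real.pi * s * ‖y‖) ^ k / k.factorial))
    (fun k => hm.mul (((((continuous_complexPairing (z • x)).const_mul _).pow k).div_const
      _).aestronglyMeasurable)) (fun k => Filter.Eventually.of_forall fun y => ?_)
    (Filter.Eventually.of_forall fun y => (hexp y).summable) ?_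
    (Filter.Eventually.of_forall fun y => ?_)
  · refine key.congr_fun fun k => ?_
    rw [← integral_const_mul, ← integral_mul_const]
    refine integral_congr_ae (Filter.Eventually.of_forall fun y => ?_)
    simp only [complexPairing_smul]
    ring
  · rw [norm_mul, norm_div, norm_pow, norm_mul, h1, complexPairing_smul, norm_mul, Complex.norm_natCast]
    have h2 : 2 * Real.pi * (‖z‖ * ‖complexPairing x y‖) ≤ 2 * Real.pi * s * ‖y‖ := by
      rw [hs, mul_assoc (2 * Real.pi), mul_assoc ‖z‖]
      exact mul_le_mul_of_nonneg_left (mul_le_mul_of_nonneg_left (norm_complexPairing_le x y)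
        (norm_nonneg z)) Real.two_pi_pos.le
    have h3 : 0 ≤ 2 * Real.pi * (‖z‖ * ‖complexPairing x y‖) := by positivity
    gcongr
  · simp only [(hexp _).tsum_eq]
    exact integrable_gaussianDamped_mul_exp hF s
  · have h := NormedSpace.expSeries_div_hasSum_exp (𝔸 := ℂ)
      (2 * Real.pi * Complex.I * complexPairing (z • x) y)
    rw [← Complex.exp_eq_exp_ℂ] at h
    exact h.mul_left _

/-- Expanding the exponential under the integral, the coefficient of z^k is a k-th moment,
polynomial in x. A single series over the polynomial ring thus encodes all lines through the origin.
-/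
theorem exists_powerSeries_entireFourierInv (hF : MemLp F 2) :
    ∃ G : PowerSeries (MvPolynomial (Fin d) ℂ), ∀ x,
      RepresentsEntire (PowerSeries.map (MvPolynomial.eval x) G)
        (fun z => entireFourierInv (gaussianDamped F) (z • x)) := by
  choose p hp using fun k => exists_polynomial_eq_integral_pairing_pow k (gaussianDamped F)
    (integrable_norm_pow_mul_gaussianDamped hF)
  refine ⟨PowerSeries.mk fun k => MvPolynomial.C ((2 * Real.pi * Complex.I) ^ k / (k.factorial : ℂ)) *
    p k, fun x z => ?_⟩
  refine (hasSum_entireFourierInv hF x z).congr_fun fun k => ?_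
  rw [PowerSeries.coeff_map, PowerSeries.coeff_mk, map_mul, MvPolynomial.eval_C, hp]

end EntireFourier

/-! ### The damped inverse transform as a Gaussian convolution -/

section Plancherel

variable {d : ℕ}

theorem polyGaussian_one_one (x : EuclideanSpace ℝ (Fin d)) :
    polyGaussian 1 1 x = (Real.exp (-Real.pi * ‖x‖ ^ 2) : ℂ) := by
  simpa using polyGaussian_one_smul_one 1 x

theorem fourier_polyGaussian_one_one_add (a y : EuclideanSpace ℝ (Fin d)) :
    𝓕 (fun t : EuclideanSpace ℝ (Fin d) => polyGaussian 1 1 (t + a)) y =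
      Complex.exp (2 * Real.pi * Complex.I * (inner ℝ a y : ℝ)) *
        (Real.exp (-Real.pi * ‖y‖ ^ 2) : ℂ) := by
  have h1 := congrFun (VectorFourier.fourierIntegral_comp_add_right Real.fourierChar volume
    (innerₗ (EuclideanSpace ℝ (Fin d))) (polyGaussian (d := d) 1 1) a) y
  have h2 := fourier_gaussian_innerProductSpace (V := EuclideanSpace ℝ (Fin d))
    (b := Real.pi) (by simpa using Real.pi_pos) y
  have h3 : (fun v : EuclideanSpace ℝ (Fin d) => Complex.exp (-Real.pi * ‖v‖ ^ 2)) =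
      polyGaussian 1 1 := by
    funext v
    rw [polyGaussian_one_one]
    push_cast
    rfl
  have hpi : (Real.pi : ℂ) ≠ 0 := Complex.ofReal_ne_zero.2 Real.pi_ne_zero
  rw [h3, div_self hpi, Complex.one_cpow, one_mul] at h2
  refine h1.trans ?_
  rw [show VectorFourier.fourierIntegral Real.fourierChar volume
    (innerₗ (EuclideanSpace ℝ (Fin d))) (polyGaussian (d := d) 1 1) y = 𝓕 (polyGaussian 1 1) y
    from rfl, h2, Circle.smul_def, Real.fourierChar_apply, smul_eq_mul, innerₗ_apply_apply]
  push_cast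
  congr 2
  · ring
  · field_simp

theorem integrable_polyGaussian_one_one_add (a : EuclideanSpace ℝ (Fin d)) :
    Integrable (fun t => polyGaussian 1 1 (t + a)) :=
  (integrable_polyGaussian 1 Matrix.PosDef.one).comp_add_right a

theorem memLp_polyGaussian_one_one_add (a : EuclideanSpace ℝ (Fin d)) :
    MemLp (fun t => polyGaussian 1 1 (t + a)) 2 :=
  (memLp_polyGaussian 1 Matrix.PosDef.one).comp_measurePreserving
    (measurePreserving_add_right volume a)

variable (f : Lp ℂ 2 (volume : Measure (EuclideanSpace ℝ (Fin d))))

/-- Plancherel applied to f and a translated Gaussian, whose transform is a modulated Gaussian. -/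
theorem entireFourierInv_gaussianDamped_fourier (x : EuclideanSpace ℝ (Fin d)) :
    entireFourierInv (gaussianDamped ⇑(𝓕 f : Lp ℂ 2 (volume : Measure (EuclideanSpace ℝ (Fin d))))) (fun i => (x i : ℂ)) =
      ∫ t, (Real.exp (-Real.pi * ‖t - x‖ ^ 2) : ℂ) * f t := by
  have h1 := Lp.inner_fourier_eq ((memLp_polyGaussian_one_one_add (-x)).toLp _) f
  rw [L2.inner_def, L2.inner_def] at h1
  refine Eq.trans ?_ (h1.trans ?_)
  · refine integral_congr_ae ?_
    filter_upwards [fourier_toLp_ae_eq (integrable_polyGaussian_one_one_add (-x))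
      (memLp_polyGaussian_one_one_add (-x))] with y hy
    rw [hy, fourier_polyGaussian_one_one_add, complexPairing_ofReal, gaussianDamped,
      RCLike.inner_apply, map_mul, Complex.conj_ofReal, ← Complex.exp_conj]
    simp only [map_mul, Complex.conj_ofReal, Complex.conj_I, inner_neg_left, Complex.ofReal_neg,
      map_neg, map_ofNat]
    ring_nf
  · refine integral_congr_ae ?_
    filter_upwards [(memLp_polyGaussian_one_one_add (-x)).coeFn_toLp] with t ht
    rw [ht, polyGaussian_one_one, RCLike.inner_apply, Complex.conj_ofReal, ← sub_eq_add_neg,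
      mul_comm]

theorem norm_entireFourierInv_gaussianDamped_fourier_le (x : EuclideanSpace ℝ (Fin d)) :
    ‖entireFourierInv (gaussianDamped ⇑(𝓕 f : Lp ℂ 2 (volume : Measure (EuclideanSpace ℝ (Fin d))))) (fun i => (x i : ℂ))‖ ≤
      ∫ t, Real.exp (-Real.pi * ‖t - x‖ ^ 2) * ‖f t‖ := by
  rw [entireFourierInv_gaussianDamped_fourier]
  refine (norm_integral_le_integral_norm _).trans_eq (integral_congr_ae
    (Filter.Eventually.of_forall fun t => ?_))
  simp only [norm_mul, Complex.norm_of_nonneg (Real.exp_pos _).le]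

theorem integrable_exp_mul_norm (x : EuclideanSpace ℝ (Fin d)) :
    Integrable fun t => Real.exp (-Real.pi * ‖t - x‖ ^ 2) * ‖f t‖ := by
  refine ((memLp_polyGaussian_one_one_add (-x)).norm.integrable_mul (Lp.memLp f).norm).congr
    (Filter.Eventually.of_forall fun t => ?_)
  simp only [Pi.mul_apply, polyGaussian_one_one, ← sub_eq_add_neg,
    Complex.norm_of_nonneg (Real.exp_pos _).le]

theorem fourierInv_gaussianDamped_eq (F : EuclideanSpace ℝ (Fin d) → ℂ)
    (x : EuclideanSpace ℝ (Fin d)) :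
    𝓕⁻ (gaussianDamped F) x = entireFourierInv (gaussianDamped F) (fun i => (x i : ℂ)) := by
  rw [Real.fourierInv_eq', entireFourierInv]
  refine integral_congr_ae (Filter.Eventually.of_forall fun y => ?_)
  simp only [complexPairing_ofReal, smul_eq_mul, real_inner_comm]
  push_cast
  ring_nf

/-- The damped function lies in L¹ ∩ L² and has zero transform, so it vanishes; the Gaussian factor
is never zero, and f has the same norm as its transform. -/
theorem eq_zero_of_entireFourierInv_gaussianDamped_eq_zero
    (h : ∀ x : EuclideanSpace ℝ (Fin d),
      entireFourierInv (gaussianDamped ⇑(𝓕 f : Lp ℂ 2 (volume : Measure (EuclideanSpace ℝ (Fin d))))) (fun i => (x i : ℂ)) = 0) : f = 0 := by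
  have hF := Lp.memLp (𝓕 f)
  have h1 := fourier_toLp_ae_eq (integrable_gaussianDamped hF) (memLp_gaussianDamped hF)
  have h2 : 𝓕 (gaussianDamped ⇑(𝓕 f : Lp ℂ 2 (volume : Measure (EuclideanSpace ℝ (Fin d))))) = 0 := by
    funext y
    rw [← neg_neg y, ← Real.fourierInv_eq_fourier_neg, fourierInv_gaussianDamped_eq, h]
    rfl
  rw [h2] at h1
  have h3 : 𝓕 ((memLp_gaussianDamped hF).toLp _) = 0 := Lp.ext (h1.trans (Lp.coeFn_zero _ _ _).symm)
  rw [← norm_eq_zero, Lp.norm_fourier_eq, norm_eq_zero] at h3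
  have h4 := (memLp_gaussianDamped hF).coeFn_toLp
  rw [h3] at h4
  rw [← norm_eq_zero, ← Lp.norm_fourier_eq, norm_eq_zero]
  refine Lp.ext (Filter.EventuallyEq.trans ?_ (Lp.coeFn_zero _ _ _).symm)
  filter_upwards [h4, Lp.coeFn_zero ℂ 2 (volume : Measure (EuclideanSpace ℝ (Fin d)))] with y hy hy0
  rw [hy0, Pi.zero_apply, gaussianDamped, eq_comm, mul_eq_zero] at hy
  exact hy.resolve_right (Complex.ofReal_ne_zero.2 (Real.exp_pos _).ne')

end Plancherel

/-! ### Transfer of the growth hypothesis to the damped inverse transform -/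

section Growth

variable {d : ℕ}

/-- To be read with T = ‖t‖, a = ‖t - x‖, b = ‖y‖, X = ‖x‖. The Gaussian confines a to the vicinity
of b, so a costs only powers of 1 + X + b; m spare powers are spent on integrable decay in a. -/
theorem exists_pow_mul_exp_neg_sub_sq_le (N m : ℕ) :
    ∃ K : ℝ, 0 ≤ K ∧ ∀ T a b X : ℝ, 0 ≤ T → 0 ≤ a → 0 ≤ b → 0 ≤ X → T ≤ X + a →
      (1 + T + b) ^ N * Real.exp (-(Real.pi * (a - b) ^ 2)) ≤
        K * (1 + X + b) ^ (N + m) * (1 + a) ^ (-(m : ℝ)) := by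
  obtain ⟨C, hC0, hC⟩ := exists_one_add_pow_mul_exp_neg_sq_le (N + m) Real.pi_pos
  refine ⟨2 ^ (N + m) * C, by positivity, fun T a b X hT ha hb hX h => ?_⟩
  have hρ := abs_nonneg (a - b)
  have hab := le_abs_self (a - b)
  have hmul := mul_nonneg (add_nonneg hX hb) hρ
  have h1 : 1 + T + b ≤ 2 * (1 + X + b) * (1 + |a - b|) := by nlinarith
  have h2 : 1 + a ≤ 2 * (1 + X + b) * (1 + |a - b|) := by nlinarith
  have h3 := hC |a - b| hρ
  rw [sq_abs] at h3
  rw [Real.rpow_neg (by positivity), Real.rpow_natCast, ← div_eq_mul_inv,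
    le_div_iff₀ (by positivity)]
  calc (1 + T + b) ^ N * Real.exp (-(Real.pi * (a - b) ^ 2)) * (1 + a) ^ m
      = (1 + T + b) ^ N * (1 + a) ^ m * Real.exp (-(Real.pi * (a - b) ^ 2)) := by ring
    _ ≤ (2 * (1 + X + b) * (1 + |a - b|)) ^ N * (2 * (1 + X + b) * (1 + |a - b|)) ^ m *
        Real.exp (-(Real.pi * (a - b) ^ 2)) := by gcongr
    _ = 2 ^ (N + m) * (1 + X + b) ^ (N + m) *
        ((1 + |a - b|) ^ (N + m) * Real.exp (-(Real.pi * (a - b) ^ 2))) := by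
      rw [← pow_add, mul_pow, mul_pow]; ring
    _ ≤ 2 ^ (N + m) * (1 + X + b) ^ (N + m) * C := by gcongr
    _ = _ := by ring

theorem integrable_one_add_norm_rpow :
    Integrable fun y : EuclideanSpace ℝ (Fin d) => (1 + ‖y‖) ^ (-((d + 1 : ℕ) : ℝ)) :=
  integrable_one_add_norm (by simp)

variable (f : Lp ℂ 2 (volume : Measure (EuclideanSpace ℝ (Fin d))))

theorem exists_entireFourierInv_mul_le (C : ℝ) (hC : 0 ≤ C) (N : ℕ) :
    ∃ K : ℝ, 0 ≤ K ∧ ∀ (F : EuclideanSpace ℝ (Fin d) → ℂ) (y : EuclideanSpace ℝ (Fin d)),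
      (∀ᵐ t, ‖f t‖ * ‖F y‖ * Real.exp (2 * Real.pi * |inner ℝ t y|) ≤
        C * (1 + ‖t‖ + ‖y‖) ^ N) → ∀ x : EuclideanSpace ℝ (Fin d),
      ‖entireFourierInv (gaussianDamped
        ⇑(𝓕 f : Lp ℂ 2 (volume : Measure (EuclideanSpace ℝ (Fin d))))) (fun i => (x i : ℂ))‖ *
        ‖gaussianDamped F y‖ * Real.exp (2 * Real.pi * |inner ℝ x y|) ≤
        K * (1 + ‖x‖ + ‖y‖) ^ (N + (d + 1)) := by
  obtain ⟨K, hK0, hK⟩ := exists_pow_mul_exp_neg_sub_sq_le N (d + 1)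
  set I := ∫ y : EuclideanSpace ℝ (Fin d), (1 + ‖y‖) ^ (-((d + 1 : ℕ) : ℝ)) with hI
  have hI0 : 0 ≤ I := integral_nonneg fun y => by positivity
  refine ⟨C * K * I, by positivity, fun F y hy x => ?_⟩
  set W := ‖gaussianDamped F y‖ * Real.exp (2 * Real.pi * |inner ℝ x y|) with hW
  have hpt : ∀ᵐ t, Real.exp (-Real.pi * ‖t - x‖ ^ 2) * ‖f t‖ * W ≤
      C * K * (1 + ‖x‖ + ‖y‖) ^ (N + (d + 1)) * (1 + ‖t - x‖) ^ (-((d + 1 : ℕ) : ℝ)) := by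
    filter_upwards [hy] with t ht
    have hin : |inner ℝ x y| ≤ |inner ℝ t y| + ‖t - x‖ * ‖y‖ := by
      have h1 : inner ℝ x y = inner ℝ t y - inner ℝ (t - x) y := by
        rw [inner_sub_left]; ring
      rw [h1]
      exact (abs_sub _ _).trans (add_le_add_right (abs_real_inner_le_norm _ _) _)
    have htx : ‖t‖ ≤ ‖x‖ + ‖t - x‖ := by
      simpa using norm_add_le x (t - x)
    calc Real.exp (-Real.pi * ‖t - x‖ ^ 2) * ‖f t‖ * W
        = ‖f t‖ * ‖F y‖ * Real.exp (-Real.pi * ‖t - x‖ ^ 2 + -Real.pi * ‖y‖ ^ 2 +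
          2 * Real.pi * |inner ℝ x y|) := by
          rw [hW, norm_gaussianDamped, Real.exp_add, Real.exp_add]; ring
      -- Replacing x by t in the weight costs 2π‖t - x‖‖y‖, which completes the square with the
      -- convolution Gaussian and the damping.
      _ ≤ ‖f t‖ * ‖F y‖ * Real.exp (2 * Real.pi * |inner ℝ t y| +
          -(Real.pi * (‖t - x‖ - ‖y‖) ^ 2)) := by
          refine mul_le_mul_of_nonneg_left (Real.exp_le_exp.2 ?_) (by positivity)
          nlinarith [mul_le_mul_of_nonneg_left hin Real.two_pi_pos.le]
      _ = ‖f t‖ * ‖F y‖ * Real.exp (2 * Real.pi * |inner ℝ t y|) *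
          Real.exp (-(Real.pi * (‖t - x‖ - ‖y‖) ^ 2)) := by rw [Real.exp_add]; ring
      _ ≤ C * (1 + ‖t‖ + ‖y‖) ^ N * Real.exp (-(Real.pi * (‖t - x‖ - ‖y‖) ^ 2)) := by gcongr
      _ = C * ((1 + ‖t‖ + ‖y‖) ^ N * Real.exp (-(Real.pi * (‖t - x‖ - ‖y‖) ^ 2))) := by ring
      _ ≤ C * (K * (1 + ‖x‖ + ‖y‖) ^ (N + (d + 1)) * (1 + ‖t - x‖) ^ (-((d + 1 : ℕ) : ℝ))) := by
          exact mul_le_mul_of_nonneg_left (hK _ _ _ _ (norm_nonneg _) (norm_nonneg _)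
            (norm_nonneg _) (norm_nonneg _) htx) hC
      _ = _ := by ring
  have hint : Integrable fun t => (1 + ‖t - x‖) ^ (-((d + 1 : ℕ) : ℝ)) :=
    (integrable_one_add_norm_rpow (d := d)).comp_sub_right x
  have h1 := norm_entireFourierInv_gaussianDamped_fourier_le f x
  rw [mul_assoc]
  calc _ ≤ (∫ t, Real.exp (-Real.pi * ‖t - x‖ ^ 2) * ‖f t‖) * W :=
        mul_le_mul_of_nonneg_right h1 (by positivity)
    _ = ∫ t, Real.exp (-Real.pi * ‖t - x‖ ^ 2) * ‖f t‖ * W := (integral_mul_const _ _).symm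
    _ ≤ ∫ t, C * K * (1 + ‖x‖ + ‖y‖) ^ (N + (d + 1)) *
        (1 + ‖t - x‖) ^ (-((d + 1 : ℕ) : ℝ)) :=
        integral_mono_ae ((integrable_exp_mul_norm f x).mul_const W) (hint.const_mul _) hpt
    _ = C * K * (1 + ‖x‖ + ‖y‖) ^ (N + (d + 1)) * I := by
        rw [integral_const_mul, hI,
          integral_sub_right_eq_self (fun t => (1 + ‖t‖) ^ (-((d + 1 : ℕ) : ℝ))) x]
    _ = _ := by ring

/-- The kernel at wx has modulus exp(-2π Im w ⟨x,y⟩): the real part of w plays no role. -/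
theorem norm_entireFourierInv_smul_le {F : EuclideanSpace ℝ (Fin d) → ℂ} (hF : MemLp F 2)
    (x : EuclideanSpace ℝ (Fin d)) {r : ℝ} {w : ℂ} (hw : |w.im| ≤ |r|) :
    ‖entireFourierInv (gaussianDamped F) (w • fun i => (x i : ℂ))‖ ≤
      ∫ y, ‖gaussianDamped F y‖ * Real.exp (2 * Real.pi * |inner ℝ (r • x) y|) := by
  refine norm_integral_le_of_norm_le ?_ (Filter.Eventually.of_forall fun y => ?_)
  · refine (integrable_gaussianDamped_mul_exp hF ‖r • x‖).mono'
      ((aestronglyMeasurable_gaussianDamped hF).norm.mul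
        (Continuous.aestronglyMeasurable (by fun_prop)))
      (Filter.Eventually.of_forall fun y => ?_)
    rw [Real.norm_of_nonneg (by positivity), mul_assoc (2 * Real.pi)]
    gcongr
    exact abs_real_inner_le_norm _ _
  · rw [norm_mul, Complex.norm_exp, complexPairing_smul, complexPairing_ofReal, real_inner_smul_left]
    gcongr
    have h1 : (2 * Real.pi * Complex.I * (w * ((inner ℝ x y : ℝ) : ℂ))).re =
        2 * Real.pi * (-(w.im * inner ℝ x y)) := by
      simp
    rw [h1, abs_mul]
    refine mul_le_mul_of_nonneg_left ?_ Real.two_pi_pos.le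
    refine (neg_le_abs _).trans ?_
    rw [abs_mul]
    gcongr

variable {f}

theorem exists_entireFourierInv_mul_integral_le {C : ℝ} (hC : 0 ≤ C) {N : ℕ}
    (h : ∀ᵐ y, ∀ᵐ t, ‖f t‖ *
      ‖(𝓕 f : Lp ℂ 2 (volume : Measure (EuclideanSpace ℝ (Fin d)))) y‖ *
      Real.exp (2 * Real.pi * |inner ℝ t y|) ≤ C * (1 + ‖t‖ + ‖y‖) ^ N) :
    ∃ (K : ℝ) (M : ℕ), 0 ≤ K ∧ ∀ x : EuclideanSpace ℝ (Fin d),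
      ‖entireFourierInv (gaussianDamped
        ⇑(𝓕 f : Lp ℂ 2 (volume : Measure (EuclideanSpace ℝ (Fin d))))) (fun i => (x i : ℂ))‖ *
      ∫ y, ‖gaussianDamped (𝓕 f : Lp ℂ 2 (volume : Measure (EuclideanSpace ℝ (Fin d)))) y‖ *
        Real.exp (2 * Real.pi * |inner ℝ x y|) ≤ K * (1 + ‖x‖) ^ M := by
  set F : EuclideanSpace ℝ (Fin d) → ℂ :=
    ⇑(𝓕 f : Lp ℂ 2 (volume : Measure (EuclideanSpace ℝ (Fin d)))) with hFdef
  have hF : MemLp F 2 := Lp.memLp _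
  obtain ⟨K, hK0, hK⟩ := exists_entireFourierInv_mul_le f C hC N
  set m := N + (d + 1) with hm
  set I := ∫ y : EuclideanSpace ℝ (Fin d), (1 + ‖y‖) ^ (-((d + 1 : ℕ) : ℝ)) with hI
  have hI0 : 0 ≤ I := integral_nonneg fun y => by positivity
  set W := ∫ y, gaussianWeight F y with hW
  have hW0 : 0 ≤ W := integral_nonneg fun y => gaussianWeight_nonneg y
  set S := ∫ y, ‖gaussianDamped F y‖ with hS
  have hS0 : 0 ≤ S := integral_nonneg fun y => norm_nonneg _
  have hbound : ∀ x : EuclideanSpace ℝ (Fin d),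
      ‖entireFourierInv (gaussianDamped F) (fun i => (x i : ℂ))‖ ≤ S := fun x => by
    have := norm_entireFourierInv_smul_le hF x (r := 0) (w := ((1 : ℝ) : ℂ)) (by simp)
    simpa using this
  refine ⟨K * 5 ^ (m + (d + 1)) * I + S * W, m + (d + 1), by positivity, fun x => ?_⟩
  set B := ‖entireFourierInv (gaussianDamped F) (fun i => (x i : ℂ))‖ with hB
  have hpt : ∀ᵐ y, B * (‖gaussianDamped F y‖ * Real.exp (2 * Real.pi * |inner ℝ x y|)) ≤
      K * (5 * (1 + ‖x‖)) ^ (m + (d + 1)) * (1 + ‖y‖) ^ (-((d + 1 : ℕ) : ℝ)) +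
        S * gaussianWeight F y := by
    filter_upwards [h] with y hy
    -- For ‖y‖ ≤ 4‖x‖ the pointwise bound is polynomial in x, and d + 1 powers of 1 + ‖y‖ are traded
    -- for integrability. For ‖y‖ ≥ 4‖x‖, 2π|⟨x,y⟩| ≤ π‖y‖²/2, and half of the damping suffices.
    rcases le_total ‖y‖ (4 * ‖x‖) with hyx | hyx
    · refine le_add_of_le_of_nonneg ?_ (mul_nonneg hS0 (gaussianWeight_nonneg y))
      rw [Real.rpow_neg (by positivity), Real.rpow_natCast, ← div_eq_mul_inv,
        le_div_iff₀ (by positivity)]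
      calc _ ≤ K * (1 + ‖x‖ + ‖y‖) ^ m * (1 + ‖y‖) ^ (d + 1) := by
            refine mul_le_mul_of_nonneg_right ?_ (by positivity)
            rw [← mul_assoc]
            exact hK F y hy x
        _ ≤ K * (5 * (1 + ‖x‖)) ^ m * (5 * (1 + ‖x‖)) ^ (d + 1) := by
            have hx := norm_nonneg x
            gcongr <;> linarith
        _ = _ := by rw [pow_add _ m, mul_assoc]
    · refine le_add_of_nonneg_of_le (by positivity) ?_
      refine mul_le_mul (hbound x) ?_ (by positivity) hS0
      rw [norm_gaussianDamped, gaussianWeight, mul_assoc, ← Real.exp_add]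
      refine mul_le_mul_of_nonneg_left (Real.exp_le_exp.2 ?_) (norm_nonneg _)
      have h1 : |inner ℝ x y| ≤ ‖y‖ ^ 2 / 4 := by
        refine (abs_real_inner_le_norm _ _).trans ?_
        nlinarith [norm_nonneg y]
      nlinarith [mul_le_mul_of_nonneg_left h1 Real.two_pi_pos.le]
  have hint1 := ((integrable_one_add_norm_rpow (d := d)).const_mul
    (K * (5 * (1 + ‖x‖)) ^ (m + (d + 1))))
  have hint2 := (integrable_gaussianWeight hF).const_mul S
  rw [← integral_const_mul]
  calc _ ≤ ∫ y, (K * (5 * (1 + ‖x‖)) ^ (m + (d + 1)) * (1 + ‖y‖) ^ (-((d + 1 : ℕ) : ℝ)) +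
        S * gaussianWeight F y) :=
        integral_mono_of_nonneg (Filter.Eventually.of_forall fun y => by positivity)
          (hint1.add hint2) hpt
    _ = K * (5 * (1 + ‖x‖)) ^ (m + (d + 1)) * I + S * W * 1 := by
        rw [integral_add hint1 hint2, integral_const_mul, integral_const_mul, mul_one]
    _ ≤ K * (5 * (1 + ‖x‖)) ^ (m + (d + 1)) * I + S * W * (1 + ‖x‖) ^ (m + (d + 1)) := by
        gcongr
        exact one_le_pow₀ (by linarith [norm_nonneg x])
    _ = _ := by rw [mul_pow]; ring

theorem exists_entireFourierInv_cross_le {C : ℝ} (hC : 0 ≤ C) {N : ℕ}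
    (h : ∀ᵐ y, ∀ᵐ t, ‖f t‖ *
      ‖(𝓕 f : Lp ℂ 2 (volume : Measure (EuclideanSpace ℝ (Fin d)))) y‖ *
      Real.exp (2 * Real.pi * |inner ℝ t y|) ≤ C * (1 + ‖t‖ + ‖y‖) ^ N) :
    ∃ M : ℕ, ∀ x : Fin d → ℝ, ∃ C, ∀ (r : ℝ) (w : ℂ), |w.im| ≤ |r| →
      ‖entireFourierInv (gaussianDamped
        ⇑(𝓕 f : Lp ℂ 2 (volume : Measure (EuclideanSpace ℝ (Fin d)))))
          ((r : ℂ) • fun i => (x i : ℂ))‖ *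
      ‖entireFourierInv (gaussianDamped
        ⇑(𝓕 f : Lp ℂ 2 (volume : Measure (EuclideanSpace ℝ (Fin d)))))
          (w • fun i => (x i : ℂ))‖ ≤ C * (1 + |r|) ^ M := by
  obtain ⟨K, M, hK0, hK⟩ := exists_entireFourierInv_mul_integral_le hC h
  refine ⟨M, fun x => ⟨K * (1 + ‖(WithLp.toLp 2 x : EuclideanSpace ℝ (Fin d))‖) ^ M,
    fun r w hw => ?_⟩⟩
  set X : EuclideanSpace ℝ (Fin d) := WithLp.toLp 2 x with hX
  have h1 := norm_entireFourierInv_smul_le (Lp.memLp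
    (𝓕 f : Lp ℂ 2 (volume : Measure (EuclideanSpace ℝ (Fin d))))) X hw
  have h2 := hK (r • X)
  have h3 : (fun i => ((r • X) i : ℂ)) = (r : ℂ) • fun i => (x i : ℂ) := by
    funext i
    simp [hX]
  rw [h3] at h2
  refine (mul_le_mul_of_nonneg_left h1 (norm_nonneg _)).trans (h2.trans ?_)
  rw [mul_assoc, ← mul_pow, norm_smul, Real.norm_eq_abs]
  have := abs_nonneg r
  have := norm_nonneg X
  gcongr
  nlinarith

end Growth

/-! ### Removing the damping and conclusion -/

section Characterization

variable {d : ℕ}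

/-- Both orders of the quantifiers serve: fixed y for the bound on the convolution, fixed x for the
decay of the transform. -/
theorem IsSlowlyIncreasing.exists_ae_ae_le {f F : EuclideanSpace ℝ (Fin d) → ℂ}
    (h : IsSlowlyIncreasing fun z : EuclideanSpace ℝ (Fin d) × EuclideanSpace ℝ (Fin d) =>
      f z.1 * F z.2 * (Real.exp (2 * Real.pi * |inner ℝ z.1 z.2|) : ℂ)) :
    ∃ (C : ℝ) (N : ℕ), 0 ≤ C ∧
      (∀ᵐ x, ∀ᵐ y, ‖f x‖ * ‖F y‖ * Real.exp (2 * Real.pi * |inner ℝ x y|) ≤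
        C * (1 + ‖x‖ + ‖y‖) ^ N) ∧
      ∀ᵐ y, ∀ᵐ x, ‖f x‖ * ‖F y‖ * Real.exp (2 * Real.pi * |inner ℝ x y|) ≤
        C * (1 + ‖x‖ + ‖y‖) ^ N := by
  obtain ⟨C, N, h⟩ := h
  have h' : ∀ᵐ z : EuclideanSpace ℝ (Fin d) × EuclideanSpace ℝ (Fin d),
      ‖f z.1‖ * ‖F z.2‖ * Real.exp (2 * Real.pi * |inner ℝ z.1 z.2|) ≤
        |C| * (1 + ‖z.1‖ + ‖z.2‖) ^ N := by
    filter_upwards [h] with z hz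
    rw [norm_mul, norm_mul, Complex.norm_of_nonneg (Real.exp_pos _).le] at hz
    exact hz.trans (by gcongr; exact le_abs_self C)
  exact ⟨|C|, N, abs_nonneg C, Measure.ae_ae_of_ae_prod h',
    Measure.ae_ae_of_ae_prod (Measure.measurePreserving_swap.quasiMeasurePreserving.ae h')⟩

theorem MvPolynomial.exists_matrix_of_eval_smul {Q : MvPolynomial (Fin d) ℂ}
    (hQ : ∀ (t : ℂ) (x : Fin d → ℂ), eval (t • x) Q = t ^ 2 * eval x Q)
    (him : ∀ x : Fin d → ℝ, (eval (fun i => (x i : ℂ)) Q).im = 0) :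
    ∃ B : Matrix (Fin d) (Fin d) ℝ, B.IsSymm ∧
      ∀ x : Fin d → ℝ, eval (fun i => (x i : ℂ)) Q = (-Real.pi * ((B *ᵥ x) ⬝ᵥ x) : ℝ) := by
  obtain ⟨B, hB⟩ := exists_quadratic_of_eval_smul hQ
  -- Real parts suffice since the form is real on real vectors. The matrix is symmetrized, with -1/π
  -- and the averaging 1/2 combined.
  refine ⟨fun i j => -((B i j).re + (B j i).re) / (2 * Real.pi), ?_, fun x => ?_⟩
  · refine Matrix.IsSymm.ext fun i j => ?_
    rw [add_comm]
  · refine Complex.ext ?_ (by rw [him, Complex.ofReal_im])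
    have h1 : (eval (fun i => (x i : ℂ)) Q).re = ∑ i, ∑ j, (B i j).re * x i * x j := by
      simp [hB]
    have h2 : ∑ i, ∑ j, (B i j).re * x i * x j = ∑ i, ∑ j, (B j i).re * x i * x j := by
      rw [Finset.sum_comm]
      exact Finset.sum_congr rfl fun i _ => Finset.sum_congr rfl fun j _ => by ring
    have h3 : -Real.pi * ∑ i, (∑ j, -((B i j).re + (B j i).re) / (2 * Real.pi) * x j) * x i =
        (∑ i, ∑ j, (B i j).re * x i * x j + ∑ i, ∑ j, (B j i).re * x i * x j) / 2 := by
      rw [← Finset.sum_add_distrib, Finset.sum_div, Finset.mul_sum]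
      refine Finset.sum_congr rfl fun i _ => ?_
      rw [← Finset.sum_add_distrib, Finset.sum_div, Finset.sum_mul, Finset.mul_sum]
      refine Finset.sum_congr rfl fun j _ => ?_
      field_simp
    rw [h1, Complex.ofReal_re]
    refine Eq.trans ?_ h3.symm
    rw [← h2]
    ring

theorem tendsto_add_smul_cocompact {E : Type*} [NormedAddCommGroup E] [NormedSpace ℝ E]
    [FiniteDimensional ℝ E] (u : E) {v : E} (hv : v ≠ 0) :
    Filter.Tendsto (fun r : ℝ => u + r • v) Filter.atTop (Filter.cocompact E) := by
  have : ProperSpace E := FiniteDimensional.proper_real E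
  rw [← Metric.cobounded_eq_cocompact, ← tendsto_norm_atTop_iff_cobounded]
  refine Filter.tendsto_atTop_mono' _ ?_ (Filter.tendsto_atTop_add_const_right _ (-‖u‖)
    (Filter.tendsto_id.atTop_mul_const (norm_pos_iff.2 hv)))
  filter_upwards [Filter.eventually_ge_atTop 0] with r hr
  have h1 := norm_sub_norm_le (r • v) (-u)
  rw [norm_smul, Real.norm_of_nonneg hr, norm_neg, sub_neg_eq_add, add_comm (r • v)] at h1
  exact h1

theorem MvPolynomial.exists_eval_neg (T : MvPolynomial (Fin d) ℂ) :
    ∃ T' : MvPolynomial (Fin d) ℂ, ∀ x : Fin d → ℂ, eval x T' = eval (fun i => -x i) T := by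
  induction T using MvPolynomial.induction_on with
  | C a => exact ⟨C a, fun x => by simp⟩
  | add p q hp hq =>
    obtain ⟨p', hp⟩ := hp
    obtain ⟨q', hq⟩ := hq
    exact ⟨p' + q', fun x => by simp [hp, hq]⟩
  | mul_X p i hp =>
    obtain ⟨p', hp⟩ := hp
    exact ⟨-(p' * X i), fun x => by simp [hp]⟩

theorem ae_inner_ne_zero {v : EuclideanSpace ℝ (Fin d)} (hv : v ≠ 0) :
    ∀ᵐ x : EuclideanSpace ℝ (Fin d), inner ℝ x v ≠ 0 := by
  have h1 : (LinearMap.ker (innerₗ (EuclideanSpace ℝ (Fin d)) v)) ≠ ⊤ := fun h => by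
    have h2 : v ∈ LinearMap.ker (innerₗ (EuclideanSpace ℝ (Fin d)) v) := h ▸ Submodule.mem_top
    rw [LinearMap.mem_ker, innerₗ_apply_apply] at h2
    exact hv (inner_self_eq_zero.1 h2)
  have h3 := Measure.addHaar_submodule (volume : Measure (EuclideanSpace ℝ (Fin d))) _ h1
  filter_upwards [measure_eq_zero_iff_ae_notMem.1 h3] with x hx
  rw [real_inner_comm]
  simpa using hx

theorem tendsto_pow_mul_exp_neg_abs (a b c k : ℝ) (hc : c ≠ 0) (ha : 0 ≤ a) (hb : 0 ≤ b) (N : ℕ) :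
    Filter.Tendsto (fun r : ℝ => (a + |r| * b) ^ N * Real.exp (-(2 * Real.pi * |k + r * c|)))
      Filter.atTop (nhds 0) := by
  set κ := 2 * Real.pi * |c| with hκ
  have hκ0 : 0 < κ := by positivity
  have h1 := ((tendsto_rpow_mul_exp_neg_mul_atTop_nhds_zero N κ hκ0).comp
    (Filter.tendsto_atTop_add_const_left _ 1 Filter.tendsto_id)).const_mul
      ((a + b) ^ N * Real.exp (κ + 2 * Real.pi * |k|))
  rw [mul_zero] at h1
  refine squeeze_zero' (Filter.Eventually.of_forall fun r => by positivity) ?_ h1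
  filter_upwards [Filter.eventually_ge_atTop 0] with r hr
  simp only [Function.comp_apply, id, Real.rpow_natCast]
  have h2 : a + |r| * b ≤ (a + b) * (1 + r) := by
    rw [abs_of_nonneg hr]
    nlinarith
  have h3 : r * |c| ≤ |k + r * c| + |k| := by
    have := abs_sub (k + r * c) k
    rwa [add_sub_cancel_left, abs_mul, abs_of_nonneg hr] at this
  calc (a + |r| * b) ^ N * Real.exp (-(2 * Real.pi * |k + r * c|))
      ≤ ((a + b) * (1 + r)) ^ N * Real.exp (κ + 2 * Real.pi * |k| + -κ * (1 + r)) := by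
        refine mul_le_mul (pow_le_pow_left₀ (by positivity) h2 N) (Real.exp_le_exp.2 ?_)
          (by positivity) (by positivity)
        rw [hκ]
        nlinarith [mul_le_mul_of_nonneg_left h3 Real.two_pi_pos.le]
    _ = _ := by rw [Real.exp_add, mul_pow]; ring

/-- For a direction v, choose x with f(x) ≠ 0 and ⟨x,v⟩ ≠ 0 for which the bound holds at almost
every y. The weight exp(2π|⟨x,y⟩|) grows exponentially along u + rv, so the polynomial Gaussian
tends to zero there. -/
theorem posDef_of_ae_eq_polyGaussian {f F : EuclideanSpace ℝ (Fin d) → ℂ} {C : ℝ} {N : ℕ}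
    (h : ∀ᵐ x, ∀ᵐ y, ‖f x‖ * ‖F y‖ * Real.exp (2 * Real.pi * |inner ℝ x y|) ≤
        C * (1 + ‖x‖ + ‖y‖) ^ N) (hf : ¬ f =ᵐ[volume] 0)
    {D : Matrix (Fin d) (Fin d) ℝ} (hD : D.IsSymm) {Q : MvPolynomial (Fin d) ℂ}
    (hF : F =ᵐ[volume] polyGaussian Q D) (hF0 : ¬ F =ᵐ[volume] 0) : D.PosDef := by
  obtain ⟨u, hu⟩ : ∃ u : EuclideanSpace ℝ (Fin d), polyGaussian Q D u ≠ 0 := by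
    by_contra! h0
    exact hF0 (hF.trans (Filter.Eventually.of_forall h0))
  refine posDef_of_tendsto_polyGaussian hD hu fun v hv => ?_
  obtain ⟨x, hx0, hxv, hx⟩ : ∃ x, f x ≠ 0 ∧ inner ℝ x v ≠ 0 ∧ ∀ᵐ y,
      ‖f x‖ * ‖F y‖ * Real.exp (2 * Real.pi * |inner ℝ x y|) ≤ C * (1 + ‖x‖ + ‖y‖) ^ N := by
    by_contra h0
    refine hf ?_
    filter_upwards [h, ae_inner_ne_zero hv] with x h1 h2
    by_contra h3
    exact h0 ⟨x, h3, h2, h1⟩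
  -- Lines may be null sets, so the bound is first extended to every y by continuity.
  have hall : ∀ y, ‖f x‖ * ‖polyGaussian Q D y‖ * Real.exp (2 * Real.pi * |inner ℝ x y|) ≤
      C * (1 + ‖x‖ + ‖y‖) ^ N := by
    have hae : ∀ᵐ y, ‖f x‖ * ‖polyGaussian Q D y‖ * Real.exp (2 * Real.pi * |inner ℝ x y|) ≤
        C * (1 + ‖x‖ + ‖y‖) ^ N := by
      filter_upwards [hx, hF] with y h1 h2
      rwa [← h2]
    have hcont := continuous_polyGaussian Q D
    have hclosed : IsClosed {y | ‖f x‖ * ‖polyGaussian Q D y‖ *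
        Real.exp (2 * Real.pi * |inner ℝ x y|) ≤ C * (1 + ‖x‖ + ‖y‖) ^ N} :=
      isClosed_le (by fun_prop) (by fun_prop)
    have := (Measure.dense_of_ae hae).closure_eq
    rw [hclosed.closure_eq] at this
    exact fun y => this.ge (Set.mem_univ y)
  have hfx : 0 < ‖f x‖ := norm_pos_iff.2 hx0
  have hlim := (tendsto_pow_mul_exp_neg_abs (1 + ‖x‖ + ‖u‖) ‖v‖ (inner ℝ x v) (inner ℝ x u) hxv
    (by positivity) (norm_nonneg v) N).const_mul (|C| / ‖f x‖)
  rw [mul_zero] at hlim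
  refine squeeze_zero_norm (fun r => ?_) hlim
  have h1 := hall (u + r • v)
  rw [inner_add_right, real_inner_smul_right] at h1
  have h2 : ‖u + r • v‖ ≤ ‖u‖ + |r| * ‖v‖ := by
    simpa [norm_smul] using norm_add_le u (r • v)
  rw [Real.exp_neg, ← div_eq_mul_inv, div_mul_div_comm, le_div_iff₀ (by positivity)]
  calc _ = ‖f x‖ * ‖polyGaussian Q D (u + r • v)‖ *
        Real.exp (2 * Real.pi * |inner ℝ x u + r * inner ℝ x v|) := by ring
    _ ≤ C * (1 + ‖x‖ + ‖u + r • v‖) ^ N := h1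
    _ ≤ |C| * (1 + ‖x‖ + ‖u‖ + |r| * ‖v‖) ^ N := by
      refine mul_le_mul (le_abs_self C) (pow_le_pow_left₀ (by positivity) (by linarith) N)
        (by positivity) (abs_nonneg C)

theorem polyGaussian_sub_one {Q : MvPolynomial (Fin d) ℂ} {B : Matrix (Fin d) (Fin d) ℝ}
    {F : EuclideanSpace ℝ (Fin d) → ℂ} (h : gaussianDamped F =ᵐ[volume] polyGaussian Q B) :
    F =ᵐ[volume] polyGaussian Q (B - 1) := by
  filter_upwards [h] with y hy
  have h1 : (Real.exp (-Real.pi * ‖y‖ ^ 2) : ℂ) ≠ 0 :=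
    Complex.ofReal_ne_zero.2 (Real.exp_pos _).ne'
  refine mul_right_cancel₀ h1 (hy.trans ?_)
  rw [polyGaussian, polyGaussian, mul_assoc, ← Complex.ofReal_mul, ← Real.exp_add,
    ← real_inner_self_eq_norm_sq, EuclideanSpace.inner_eq_star_dotProduct, star_trivial,
    Matrix.sub_mulVec, Matrix.one_mulVec, sub_dotProduct]
  ring_nf

variable {f : Lp ℂ 2 (volume : Measure (EuclideanSpace ℝ (Fin d)))}

theorem exists_entireFourierInv_eq_polyGaussian (hf : f ≠ 0) {C : ℝ} (hC : 0 ≤ C) {N : ℕ}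
    (h : ∀ᵐ y, ∀ᵐ t, ‖f t‖ *
      ‖(𝓕 f : Lp ℂ 2 (volume : Measure (EuclideanSpace ℝ (Fin d)))) y‖ *
      Real.exp (2 * Real.pi * |inner ℝ t y|) ≤ C * (1 + ‖t‖ + ‖y‖) ^ N) :
    ∃ (B : Matrix (Fin d) (Fin d) ℝ) (T : MvPolynomial (Fin d) ℂ), B.PosDef ∧
      𝓕⁻ (gaussianDamped
        ⇑(𝓕 f : Lp ℂ 2 (volume : Measure (EuclideanSpace ℝ (Fin d))))) = polyGaussian T B := by
  set F : EuclideanSpace ℝ (Fin d) → ℂ :=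
    ⇑(𝓕 f : Lp ℂ 2 (volume : Measure (EuclideanSpace ℝ (Fin d)))) with hFdef
  have hF : MemLp F 2 := Lp.memLp _
  obtain ⟨x, hx⟩ : ∃ x : EuclideanSpace ℝ (Fin d),
      entireFourierInv (gaussianDamped F) (fun i => (x i : ℂ)) ≠ 0 := by
    by_contra! h0
    exact hf (eq_zero_of_entireFourierInv_gaussianDamped_eq_zero f h0)
  obtain ⟨G, hG⟩ := exists_powerSeries_entireFourierInv hF
  have hG0 : G ≠ 0 := by
    rintro rfl
    have h0 := hG (fun i => (x i : ℂ)) 1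
    simp only [map_zero, zero_mul, one_smul] at h0
    exact hx (h0.unique hasSum_zero)
  obtain ⟨M, hM⟩ := exists_entireFourierInv_cross_le hC h
  obtain ⟨T, Q, hQ, him, hg⟩ := MvPolynomial.exists_eq_polynomial_mul_exp hG hG0
    Real.two_pi_pos.le (norm_entireFourierInv_le hF) hM
  obtain ⟨B, hB, hQB⟩ := MvPolynomial.exists_matrix_of_eval_smul hQ him
  have hgB : 𝓕⁻ (gaussianDamped F) = polyGaussian T B := by
    funext y
    rw [fourierInv_gaussianDamped_eq, hg, hQB (y.ofLp), ← Complex.ofReal_exp, polyGaussian]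
  refine ⟨B, T, posDef_of_tendsto_polyGaussian (Q := T) (u := x) hB ?_ fun v hv => ?_, hgB⟩
  · rwa [← hgB, fourierInv_gaussianDamped_eq]
  · rw [← hgB]
    -- Riemann–Lebesgue: the inverse transform of an integrable function vanishes at infinity, in
    -- particular along lines.
    have h1 := tendsto_integral_exp_inner_smul_cocompact (gaussianDamped F)
    have h2 := h1.comp (tendsto_add_smul_cocompact (-x) (neg_ne_zero.2 hv))
    refine h2.congr fun r => ?_
    rw [Real.fourierInv_eq_fourier_neg, Real.fourier_eq, neg_add, ← smul_neg]
    rfl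

theorem exists_ae_eq_polyGaussian_of_isSlowlyIncreasing
    (h : IsSlowlyIncreasing fun z : EuclideanSpace ℝ (Fin d) × EuclideanSpace ℝ (Fin d) =>
      f z.1 * (𝓕 f : Lp ℂ 2 (volume : Measure (EuclideanSpace ℝ (Fin d)))) z.2 *
        (Real.exp (2 * Real.pi * |inner ℝ z.1 z.2|) : ℂ)) :
    ∃ (A : Matrix (Fin d) (Fin d) ℝ) (P : MvPolynomial (Fin d) ℂ),
      A.PosDef ∧ f =ᵐ[volume] polyGaussian P A := by
  rcases eq_or_ne f 0 with rfl | hf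
  · refine ⟨1, 0, Matrix.PosDef.one, (Lp.coeFn_zero ℂ 2 volume).trans ?_⟩
    exact Filter.Eventually.of_forall fun x => by simp [polyGaussian]
  have hne : ∀ g : Lp ℂ 2 (volume : Measure (EuclideanSpace ℝ (Fin d))), g ≠ 0 →
      ¬ g =ᵐ[volume] 0 := fun g hg h0 => hg (Lp.ext (h0.trans (Lp.coeFn_zero ℂ 2 volume).symm))
  have hFf : (𝓕 f : Lp ℂ 2 (volume : Measure (EuclideanSpace ℝ (Fin d)))) ≠ 0 := by
    rwa [← norm_ne_zero_iff, Lp.norm_fourier_eq, norm_ne_zero_iff]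
  obtain ⟨C, N, hC, h1, h2⟩ := h.exists_ae_ae_le
  obtain ⟨B, T, hB, hBT⟩ := exists_entireFourierInv_eq_polyGaussian hf hC h2
  have hF := Lp.memLp (𝓕 f : Lp ℂ 2 (volume : Measure (EuclideanSpace ℝ (Fin d))))
  obtain ⟨T', hT'⟩ := T.exists_eval_neg
  have h3 : 𝓕 (gaussianDamped
      ⇑(𝓕 f : Lp ℂ 2 (volume : Measure (EuclideanSpace ℝ (Fin d))))) = polyGaussian T' B := by
    funext y
    rw [← neg_neg y, ← Real.fourierInv_eq_fourier_neg, hBT, neg_neg, polyGaussian, polyGaussian, hT']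
    simp [Matrix.mulVec_neg]
  have h4 := fourier_toLp_ae_eq (integrable_gaussianDamped hF) (memLp_gaussianDamped hF)
  rw [h3] at h4
  obtain ⟨Q, hQ⟩ := ae_eq_polyGaussian_of_fourier hB T' _ h4
  have h5 := polyGaussian_sub_one ((memLp_gaussianDamped hF).coeFn_toLp.symm.trans hQ)
  have hsymm : (B⁻¹ - 1).IsSymm := by
    have hBs : B.IsSymm := by simpa [Matrix.IsSymm] using hB.isHermitian.eq
    exact Matrix.IsSymm.sub (by rw [Matrix.IsSymm, Matrix.transpose_nonsing_inv, hBs.eq])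
      Matrix.isSymm_one
  -- Subtracting 1 from B⁻¹ may destroy definiteness; the hypothesis on f and its transform, used a
  -- second time, restores it.
  have hD := posDef_of_ae_eq_polyGaussian h1 (hne f hf) hsymm h5 (hne _ hFf)
  obtain ⟨P, hP⟩ := ae_eq_polyGaussian_of_fourier hD Q f h5
  exact ⟨_, P, hD.inv, hP⟩

end Characterization

theorem mainTheorem7 (d : ℕ) (hd : 1 ≤ d)
    (f : Lp ℂ 2 (volume : Measure (EuclideanSpace ℝ (Fin d)))) :
    (∃ (A : Matrix (Fin d) (Fin d) ℝ) (P : MvPolynomial (Fin d) ℂ),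
        A.PosDef ∧ f =ᵐ[volume] polyGaussian P A) ↔
      IsSlowlyIncreasing
        (fun z : EuclideanSpace ℝ (Fin d) × EuclideanSpace ℝ (Fin d) =>
          f z.1 * 𝓕 f z.2 * (Real.exp (2 * Real.pi * |inner ℝ z.1 z.2|) : ℂ)) :=
  ⟨fun ⟨_, _, hA, hf⟩ => isSlowlyIncreasing_of_ae_eq_polyGaussian hA hf,
    exists_ae_eq_polyGaussian_of_isSlowlyIncreasing⟩
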